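/- Let $\nabla\wedge$ denote the curl and $\nabla$ the gradient on $\mathbb{R}^3$, both in the sense of distributions. Let $$\mathcal Y := \{A\in L^3(\mathbb{R}^3,\mathbb{R}^3):\ \nabla\wedge A\in L^{3/2}(\mathbb{R}^3,\mathbb{R}^3)\},$$ let $\dot W^{1,3}(\mathbb{R}^3)$ be the space of all real functions $\phi\in L^1_{\rm loc}(\mathbb{R}^3)$ with $\nabla\phi\in L^3(\mathbb{R}^3,\mathbb{R}^3)$, and for $A\in L^3(\mathbb{R}^3,\mathbb{R}^3)$ let $$|||A|||_3 := \inf_{\phi\in\dot W^{1,3}(\mathbb{R}^3)}\|A-\nabla\phi\|_3 .$$ Let $(A_n)\subset\mathcal Y$ be a sequence with $|||A_n|||_3=1$ for all $n$ and $\sup_n\|\nabla\wedge A_n\|_{3/2}<\infty$. Then there are $\lambda_n\in(0,\infty)$ and $a_n\in\mathbb{R}^3$ such that a subsequence of $$x\mapsto \lambda_n^2\,(\nabla\wedge A_n)(\lambda_n(x-a_n))$$ converges weakly in $L^{3/2}(\mathbb{R}^3,\mathbb{R}^3)$ to some $\tilde B\not\equiv 0$. -/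

import Mathlib

open MeasureTheory Filter Topology
open scoped ENNReal NNReal ContDiff

noncomputable section

/-- Euclidean three-space, with the Euclidean norm and Lebesgue measure. -/
abbrev E3 : Type := EuclideanSpace ℝ (Fin 3)

instance fact_one_le_three_halves : Fact ((1 : ℝ≥0∞) ≤ 3 / 2) :=
  ⟨by rw [ENNReal.le_div_iff_mul_le (by simp) (by simp)]; norm_num⟩

/-- Real-valued test functions on `ℝ³`: smooth with compact support. -/
def IsTestFunction (η : E3 → ℝ) : Prop :=
  ContDiff ℝ ∞ η ∧ HasCompactSupport η

/-- The classical `i`-th partial derivative. -/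
def partialDeriv (i : Fin 3) (η : E3 → ℝ) (x : E3) : ℝ :=
  fderiv ℝ η x (EuclideanSpace.single i 1)

/-- `G = ∇φ` in the sense of distributions, where `φ` and `G` are locally integrable. -/
def HasWeakGradient (φ : E3 → ℝ) (G : E3 → E3) : Prop :=
  LocallyIntegrable φ volume ∧ LocallyIntegrable G volume ∧
    ∀ η : E3 → ℝ, IsTestFunction η → ∀ i : Fin 3,
      ∫ x, η x * G x i = -∫ x, partialDeriv i η x * φ x

/-- `B = ∇ ∧ A` in the sense of distributions, where `A` and `B` are locally integrable.
Indices are cyclic (addition in `Fin 3`): `(∇ ∧ A)_i = ∂_{i+1} A_{i+2} - ∂_{i+2} A_{i+1}`. -/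
def HasWeakCurl (A B : E3 → E3) : Prop :=
  LocallyIntegrable A volume ∧ LocallyIntegrable B volume ∧
    ∀ η : E3 → ℝ, IsTestFunction η → ∀ i : Fin 3,
      ∫ x, η x * B x i =
        -∫ x, (partialDeriv (i + 1) η x * A x (i + 2) - partialDeriv (i + 2) η x * A x (i + 1))

/-- The space `𝒴` of fields `A ∈ L³(ℝ³, ℝ³)` with `∇ ∧ A ∈ L^{3/2}(ℝ³, ℝ³)`. -/
def SpaceY : Set (E3 → E3) :=
  {A | MemLp A 3 volume ∧ ∃ B : E3 → E3, HasWeakCurl A B ∧ MemLp B (3 / 2) volume}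

/-- The seminorm `⦀A⦀₃`, the infimum of `‖A - ∇φ‖₃` over the real `φ ∈ L¹_loc` with
`∇φ ∈ L³`. -/
def modGradNorm (A : E3 → E3) : ℝ≥0∞ :=
  sInf {N : ℝ≥0∞ | ∃ (φ : E3 → ℝ) (G : E3 → E3),
    HasWeakGradient φ G ∧ MemLp G 3 volume ∧ N = eLpNorm (fun x => A x - G x) 3 volume}

/-- `u k` converges to `v` weakly in `L^p(ℝ³, ℝ³)`: all functions are in `L^p`, and every
continuous linear functional on `L^p` converges along the sequence. -/
def TendstoWeaklyLp (p : ℝ≥0∞) [Fact (1 ≤ p)] (u : ℕ → E3 → E3) (v : E3 → E3) : Prop :=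
  ∃ (hu : ∀ k, MemLp (u k) p volume) (hv : MemLp v p volume),
    ∀ ℓ : StrongDual ℝ (Lp E3 p (volume : Measure E3)),
      Tendsto (fun k => ℓ ((hu k).toLp (u k))) atTop (𝓝 (ℓ (hv.toLp v)))

end

/-! ### The dual of `L^p` -/

section LpDual

variable {α : Type*} {m : MeasurableSpace α} {μ : Measure α} {p q : ℝ≥0∞}

theorem MeasureTheory.MemLp.tendsto_toLp_of_dominated [Fact (1 ≤ p)] (hp : p ≠ ⊤) {ι : Type*}
    {l : Filter ι} [l.IsCountablyGenerated] {F : ι → α → ℝ} {f G : α → ℝ}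
    (hF : ∀ i, MemLp (F i) p μ) (hf : MemLp f p μ) (hG : MemLp G p μ)
    (hFm : ∀ i, Measurable (F i)) (hfm : Measurable f)
    (hb : ∀ i x, |F i x| ≤ |G x|) (hfb : ∀ x, |f x| ≤ |G x|)
    (hlim : ∀ x, Tendsto (fun i => F i x) l (𝓝 (f x))) :
    Tendsto (fun i => (hF i).toLp (F i)) l (𝓝 (hf.toLp f)) := by
  have hp1 : 1 ≤ p := Fact.out
  have hp0 : p ≠ 0 := (zero_lt_one.trans_le hp1).ne'
  have hpr : 0 < p.toReal := ENNReal.toReal_pos hp0 hp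
  rw [Lp.tendsto_Lp_iff_tendsto_eLpNorm'']
  simp only [eLpNorm_eq_lintegral_rpow_enorm_toReal hp0 hp]
  have key : Tendsto (fun i => ∫⁻ x, ‖(F i - f) x‖ₑ ^ p.toReal ∂μ) l (𝓝 (∫⁻ _, 0 ∂μ)) := by
    refine tendsto_lintegral_filter_of_dominated_convergence
      (fun x => ‖(2 * G x)‖ₑ ^ p.toReal) ?_ ?_ ?_ ?_
    · filter_upwards with i
      exact ((hFm i).sub hfm).enorm.pow_const _
    · filter_upwards with i
      filter_upwards with x
      gcongr
      rw [enorm_le_iff_norm_le, Real.norm_eq_abs, Real.norm_eq_abs, abs_mul, abs_two, two_mul,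
        Pi.sub_apply]
      exact (abs_sub _ _).trans (add_le_add (hb i x) (hfb x))
    · exact (lintegral_rpow_enorm_lt_top_of_eLpNorm_lt_top hp0 hp (hG.const_mul 2).2).ne
    · filter_upwards with x
      have h1 : Tendsto (fun i => ‖(F i - f) x‖ₑ) l (𝓝 0) := by
        have := ((hlim x).sub_const (f x)).enorm
        simpa using this
      have := (ENNReal.continuous_rpow_const (y := p.toReal)).tendsto 0 |>.comp h1
      simpa [hpr, Function.comp_def] using this
  simp only [lintegral_zero] at key
  have := (ENNReal.continuous_rpow_const (y := 1 / p.toReal)).tendsto 0 |>.comp key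
  simpa [hpr, Function.comp_def] using this

theorem MeasureTheory.MemLp.toLp_eq_zero_of_ae {f : α → ℝ} (hf : MemLp f p μ) (h : f =ᵐ[μ] 0) :
    hf.toLp f = 0 :=
  (Lp.eq_zero_iff_ae_eq_zero).2 (hf.coeFn_toLp.trans h)

theorem exists_pos_memLp [SigmaFinite μ] (hp0 : p ≠ 0) (hp : p ≠ ⊤) :
    ∃ w : α → ℝ, (∀ x, 0 < w x) ∧ Measurable w ∧ MemLp w p μ := by
  obtain ⟨g, hg, hgm, hgi⟩ := exists_pos_lintegral_lt_of_sigmaFinite μ (ε := 1) one_ne_zero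
  have hpr : 0 < p.toReal := ENNReal.toReal_pos hp0 hp
  have hm : Measurable fun x => (g x : ℝ) ^ (1 / p.toReal) :=
    (measurable_coe_nnreal_real.comp hgm).pow_const _
  refine ⟨fun x => (g x : ℝ) ^ (1 / p.toReal), fun x => Real.rpow_pos_of_pos (hg x) _, hm,
    hm.aestronglyMeasurable, ?_⟩
  rw [eLpNorm_lt_top_iff_lintegral_rpow_enorm_lt_top hp0 hp]
  refine lt_of_eq_of_lt (lintegral_congr fun x => ?_) (hgi.trans ENNReal.one_lt_top)
  rw [Real.enorm_eq_ofReal (by positivity), ENNReal.ofReal_rpow_of_nonneg (by positivity) hpr.le,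
    ← Real.rpow_mul (by positivity), one_div_mul_cancel hpr.ne', Real.rpow_one,
    ENNReal.ofReal_coe_nnreal]

/-- The signed measure `E ↦ ℓ(1_E w)`. -/
noncomputable def dualSignedMeasure [Fact (1 ≤ p)] (hp : p ≠ ⊤) (ℓ : StrongDual ℝ (Lp ℝ p μ))
    {w : α → ℝ} (hwm : Measurable w) (hw : MemLp w p μ) : SignedMeasure α where
  measureOf' E := by
    classical
    exact if h : MeasurableSet E then ℓ ((hw.indicator h).toLp _) else 0
  empty' := by
    simp only [MeasurableSet.empty, Set.indicator_empty, dite_true]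
    exact map_zero ℓ
  not_measurable' E hE := by simp [hE]
  m_iUnion' E hE hd := by
    simp only [hE, MeasurableSet.iUnion hE, dite_true]
    have hpt : ∀ F : Finset ℕ, ∀ x, ∑ i ∈ F, (E i).indicator w x = (⋃ i ∈ F, E i).indicator w x := by
      intro F x
      rw [Finset.indicator_biUnion]
      · intro i _ j _ hij
        exact hd hij
    have hF : ∀ F : Finset ℕ, MemLp (fun x => ∑ i ∈ F, (E i).indicator w x) p μ := fun F =>
      memLp_finsetSum F fun i _ => hw.indicator (hE i)
    have ht := MemLp.tendsto_toLp_of_dominated (l := (atTop : Filter (Finset ℕ))) hp hF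
      (hw.indicator (MeasurableSet.iUnion hE)) hw
      (fun F => Finset.measurable_sum F fun i _ => hwm.indicator (hE i))
      (hwm.indicator (MeasurableSet.iUnion hE)) ?_ ?_ ?_
    · have := (ℓ.continuous.tendsto _).comp ht
      refine this.congr fun F => ?_
      simp only [Function.comp_apply, ← map_sum]
      congr 1
      induction F using Finset.induction_on with
      | empty => rfl
      | insert a F ha ih =>
        rw [Finset.sum_insert ha, ← ih, ← MemLp.toLp_add]
        refine MemLp.toLp_congr _ _ (ae_of_all _ fun x => ?_)
        simp [Finset.sum_insert ha]
    · intro F x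
      rw [hpt]
      by_cases h : x ∈ ⋃ i ∈ F, E i <;> simp [Set.indicator, h]
    · intro x
      by_cases h : x ∈ ⋃ i, E i <;> simp [Set.indicator, h]
    · intro x
      change HasSum (fun i => (E i).indicator w x) _
      by_cases h : x ∈ ⋃ i, E i
      · obtain ⟨i, hi⟩ := Set.mem_iUnion.1 h
        rw [Set.indicator_of_mem h, ← Set.indicator_of_mem hi w]
        refine hasSum_single i fun j hj => Set.indicator_of_notMem (fun hj' => ?_) _
        exact Set.disjoint_left.1 (hd hj) hj' hi
      · rw [Set.indicator_of_notMem h]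
        simp only [Set.mem_iUnion, not_exists] at h
        simp [Set.indicator, h]

theorem dualSignedMeasure_apply [Fact (1 ≤ p)] (hp : p ≠ ⊤) (ℓ : StrongDual ℝ (Lp ℝ p μ))
    {w : α → ℝ} (hwm : Measurable w) (hw : MemLp w p μ) {E : Set α} (hE : MeasurableSet E) :
    dualSignedMeasure hp ℓ hwm hw E = ℓ ((hw.indicator hE).toLp _) := by
  simp [dualSignedMeasure, hE]

theorem exists_integrable_forall_dual_indicator_eq [SigmaFinite μ] [Fact (1 ≤ p)] (hp : p ≠ ⊤)
    (ℓ : StrongDual ℝ (Lp ℝ p μ)) {w : α → ℝ} (hwm : Measurable w) (hw : MemLp w p μ) :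
    ∃ h : α → ℝ, Measurable h ∧ Integrable h μ ∧ ∀ (E : Set α) (hE : MeasurableSet E),
      ℓ ((hw.indicator hE).toLp _) = ∫ x in E, h x ∂μ := by
  set s := dualSignedMeasure hp ℓ hwm hw with hs
  have hac : s ≪ᵥ μ.toENNRealVectorMeasure := by
    refine VectorMeasure.AbsolutelyContinuous.mk fun E hE h0 => ?_
    rw [Measure.toENNRealVectorMeasure_apply_measurable hE] at h0
    rw [hs, dualSignedMeasure_apply hp ℓ hwm hw hE]
    have : (hw.indicator hE).toLp _ = 0 := MemLp.toLp_eq_zero_of_ae _ (indicator_meas_zero h0)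
    rw [this, map_zero]
  refine ⟨s.rnDeriv μ, SignedMeasure.measurable_rnDeriv _ _, SignedMeasure.integrable_rnDeriv _ _,
    fun E hE => ?_⟩
  rw [← dualSignedMeasure_apply hp ℓ hwm hw hE, ← hs]
  conv_lhs => rw [← SignedMeasure.withDensityᵥ_rnDeriv_eq s μ hac]
  exact withDensityᵥ_apply (SignedMeasure.integrable_rnDeriv _ _) hE

theorem dual_simpleFunc_mul_eq [Fact (1 ≤ p)]
    (ℓ : StrongDual ℝ (Lp ℝ p μ)) {w h : α → ℝ} (hw : MemLp w p μ) (hh : Integrable h μ)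
    (H : ∀ (E : Set α) (hE : MeasurableSet E),
      ℓ ((hw.indicator hE).toLp _) = ∫ x in E, h x ∂μ) (φ : SimpleFunc α ℝ) :
    ∃ hφ : MemLp (fun x => φ x * w x) p μ, ℓ (hφ.toLp _) = ∫ x, h x * φ x ∂μ := by
  have hint : ∀ φ : SimpleFunc α ℝ, Integrable (fun x => h x * φ x) μ := fun φ => by
    obtain ⟨C, hC⟩ := φ.exists_forall_norm_le
    exact hh.mul_bdd (c := C) φ.aestronglyMeasurable (ae_of_all _ hC)
  induction φ using SimpleFunc.induction with
  | const c hs =>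
    rename_i s
    have he : ∀ x, (SimpleFunc.piecewise s hs (SimpleFunc.const α c) (SimpleFunc.const α 0)) x * w x
        = c • s.indicator w x := fun x => by
      by_cases hx : x ∈ s <;> simp [hx]
    have hm : MemLp (fun x => c • s.indicator w x) p μ := (hw.indicator hs).const_smul c
    simp only [he]
    refine ⟨hm, ?_⟩
    have : hm.toLp _ = c • (hw.indicator hs).toLp _ := rfl
    rw [this, map_smul, H s hs, ← integral_indicator hs, smul_eq_mul, ← integral_const_mul]
    refine integral_congr_ae (ae_of_all _ fun x => ?_)
    by_cases hx : x ∈ s <;> simp [hx, mul_comm]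
  | @add f g _ hf hg =>
    obtain ⟨hf1, hf2⟩ := hf
    obtain ⟨hg1, hg2⟩ := hg
    have he : ∀ x, (f + g) x * w x = f x * w x + g x * w x := fun x => by
      simp [add_mul]
    have hm : MemLp (fun x => f x * w x + g x * w x) p μ := hf1.add hg1
    simp only [he]
    refine ⟨hm, ?_⟩
    have : hm.toLp _ = hf1.toLp _ + hg1.toLp _ := rfl
    rw [this, map_add, hf2, hg2, ← integral_add (hint f) (hint g)]
    refine integral_congr_ae (ae_of_all _ fun x => ?_)
    simp [mul_add]

theorem dual_bounded_mul_eq [Fact (1 ≤ p)] (hp : p ≠ ⊤)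
    (ℓ : StrongDual ℝ (Lp ℝ p μ)) {w h : α → ℝ} (hwm : Measurable w) (hw : MemLp w p μ)
    (hh : Integrable h μ)
    (H : ∀ (E : Set α) (hE : MeasurableSet E),
      ℓ ((hw.indicator hE).toLp _) = ∫ x in E, h x ∂μ) {φ : α → ℝ} (hφ : Measurable φ) {C : ℝ}
    (hC : ∀ x, |φ x| ≤ C) (hφw : MemLp (fun x => φ x * w x) p μ) :
    ℓ (hφw.toLp _) = ∫ x, h x * φ x ∂μ := by
  by_cases hC0 : 0 ≤ C
  swap
  · have : IsEmpty α := ⟨fun x => hC0 ((abs_nonneg _).trans (hC x))⟩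
    rw [show hφw.toLp _ = 0 from
      MemLp.toLp_eq_zero_of_ae _ (ae_of_all _ fun x => (IsEmpty.false x).elim)]
    simp [Measure.eq_zero_of_isEmpty μ]
  have hs := hφ.stronglyMeasurable
  choose hm he using fun n => dual_simpleFunc_mul_eq ℓ hw hh H (hs.approxBounded C n)
  have hb : ∀ n x, ‖hs.approxBounded C n x‖ ≤ C := fun n x => hs.norm_approxBounded_le hC0 n x
  have hl : ∀ x, Tendsto (fun n => hs.approxBounded C n x) atTop (𝓝 (φ x)) := fun x =>
    hs.tendsto_approxBounded_of_norm_le (hC x)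
  have h1 := MemLp.tendsto_toLp_of_dominated (l := atTop) hp hm hφw (hw.const_mul C)
    (fun n => (hs.approxBounded C n).measurable.mul hwm) (hφ.mul hwm) ?_ ?_
    (fun x => (hl x).mul_const _)
  · have h2 := (ℓ.continuous.tendsto _).comp h1
    have h3 : Tendsto (fun n => ∫ x, h x * hs.approxBounded C n x ∂μ) atTop
        (𝓝 (∫ x, h x * φ x ∂μ)) := by
      refine tendsto_integral_of_dominated_convergence (fun x => ‖h x‖ * C) (fun n => ?_)
        (hh.norm.mul_const C) (fun n => ae_of_all _ fun x => ?_)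
        (ae_of_all _ fun x => (hl x).const_mul _)
      · exact hh.1.mul (SimpleFunc.aestronglyMeasurable _)
      · rw [norm_mul]
        gcongr
        exact hb n x
    refine tendsto_nhds_unique h2 (h3.congr fun n => ?_)
    exact (he n).symm
  · intro n x
    rw [abs_mul, abs_mul, abs_of_nonneg hC0]
    gcongr
    exact hb n x
  · intro x
    rw [abs_mul, abs_mul, abs_of_nonneg hC0]
    gcongr
    exact hC x

theorem le_rpow_of_le_mul_rpow {P Q I c : ℝ} (hPQ : P.HolderConjugate Q) (hI : 0 ≤ I) (hc : 0 ≤ c)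
    (h : I ≤ c * I ^ P⁻¹) : I ≤ c ^ Q := by
  rcases hI.eq_or_lt with rfl | hI
  · positivity
  have h1 : I ^ Q⁻¹ ≤ c := by
    have h2 : I ^ P⁻¹ * I ^ Q⁻¹ = I := by
      rw [← Real.rpow_add hI, hPQ.inv_add_inv_eq_one, Real.rpow_one]
    have h3 : 0 < I ^ P⁻¹ := Real.rpow_pos_of_pos hI _
    nlinarith
  calc I = (I ^ Q⁻¹) ^ Q := by rw [← Real.rpow_mul hI.le, inv_mul_cancel₀ hPQ.symm.ne_zero, Real.rpow_one]
    _ ≤ c ^ Q := Real.rpow_le_rpow (by positivity) h1 hPQ.symm.nonneg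

theorem memLp_of_dual_bounded_mul_eq [Fact (1 ≤ p)] (hp : p ≠ ⊤) (hq : q ≠ ⊤)
    (hPQ : p.toReal.HolderConjugate q.toReal)
    (ℓ : StrongDual ℝ (Lp ℝ p μ)) {w g : α → ℝ} (hwm : Measurable w) (hw0 : ∀ x, 0 < w x)
    (hw : MemLp w p μ) (hgm : Measurable g)
    (H : ∀ (φ : α → ℝ) (C : ℝ), Measurable φ → (∀ x, |φ x| ≤ C) →
      ∀ hφw : MemLp (fun x => φ x * w x) p μ, ℓ (hφw.toLp _) = ∫ x, (g x * w x) * φ x ∂μ) :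
    MemLp g q μ := by
  set P := p.toReal with hP
  set Q := q.toReal with hQ
  have hp0 : p ≠ 0 := fun h => hPQ.ne_zero (by simp [hP, h])
  have hq0 : q ≠ 0 := fun h => hPQ.symm.ne_zero (by simp [hQ, h])
  have hQ1 : 0 < Q - 1 := by linarith [hPQ.symm.lt]
  refine ⟨hgm.aestronglyMeasurable, ?_⟩
  rw [eLpNorm_lt_top_iff_lintegral_rpow_enorm_lt_top hq0 hq, ← hQ]
  let S : ℕ → Set α := fun k => {x | |g x| ≤ k ∧ 1 ≤ k * w x}
  have hS : ∀ k, MeasurableSet (S k) := fun k =>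
    (measurableSet_le hgm.abs measurable_const).inter
      (measurableSet_le measurable_const (hwm.const_mul _))
  let e : α → ℝ := fun x => if 0 ≤ g x then 1 else -1
  have hem : Measurable e :=
    Measurable.ite (measurableSet_le measurable_const hgm) measurable_const measurable_const
  have he1 : ∀ x, |e x| = 1 := fun x => by
    by_cases hx : 0 ≤ g x <;> simp [e, hx]
  have hge : ∀ x, g x * e x = |g x| := fun x => by
    by_cases hx : 0 ≤ g x
    · simp [e, hx, abs_of_nonneg hx]
    · simp [e, hx, abs_of_neg (not_le.1 hx)]
  let φ : ℕ → α → ℝ := fun k => (S k).indicator fun x => e x * |g x| ^ (Q - 1) / w x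
  have hφm : ∀ k, Measurable (φ k) := fun k => by
    refine Measurable.indicator ?_ (hS k)
    exact (hem.mul (hgm.abs.pow_const _)).div hwm
  have hφb : ∀ k x, |φ k x| ≤ (k : ℝ) ^ (Q - 1) * k := by
    intro k x
    by_cases hx : x ∈ S k
    · simp only [φ, Set.indicator_of_mem hx]
      rw [abs_div, abs_mul, he1, one_mul, abs_of_nonneg (by positivity), abs_of_pos (hw0 x),
        div_le_iff₀ (hw0 x), mul_assoc]
      calc |g x| ^ (Q - 1) ≤ (k : ℝ) ^ (Q - 1) := Real.rpow_le_rpow (abs_nonneg _) hx.1 hQ1.le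
        _ ≤ _ := le_mul_of_one_le_right (by positivity) hx.2
    · simp only [φ, Set.indicator_of_notMem hx, abs_zero]
      positivity
  have hφw : ∀ k, MemLp (fun x => φ k x * w x) p μ := fun k =>
    hw.of_le_mul (c := (k : ℝ) ^ (Q - 1) * k) ((hφm k).mul hwm).aestronglyMeasurable
      (ae_of_all _ fun x => by rw [norm_mul]; gcongr; exact hφb k x)
  have hpow : ∀ k x, ‖φ k x * w x‖ ^ P = (S k).indicator (fun x => |g x| ^ Q) x := by
    intro k x
    by_cases hx : x ∈ S k
    · simp only [φ, Set.indicator_of_mem hx]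
      rw [div_mul_cancel₀ _ (hw0 x).ne', Real.norm_eq_abs, abs_mul, he1, one_mul,
        abs_of_nonneg (by positivity), ← Real.rpow_mul (abs_nonneg _),
        hPQ.symm.sub_one_mul_conj]
    · simp only [φ, Set.indicator_of_notMem hx, zero_mul, norm_zero]
      exact Real.zero_rpow hPQ.ne_zero
  have hprod : ∀ k x, (g x * w x) * φ k x = (S k).indicator (fun x => |g x| ^ Q) x := by
    intro k x
    by_cases hx : x ∈ S k
    · simp only [φ, Set.indicator_of_mem hx]
      have hw' := (hw0 x).ne'
      rw [show g x * w x * (e x * |g x| ^ (Q - 1) / w x) = (g x * e x) * |g x| ^ (Q - 1) by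
        field_simp, hge]
      nth_rewrite 1 [← Real.rpow_one |g x|]
      rw [← Real.rpow_add_of_nonneg (abs_nonneg _) zero_le_one hQ1.le, add_sub_cancel]
    · simp [φ, Set.indicator_of_notMem hx]
  have hI : ∀ k, ∫ x, (S k).indicator (fun x => |g x| ^ Q) x ∂μ ≤ ‖ℓ‖ ^ Q := by
    intro k
    have h1 := H (φ k) _ (hφm k) (hφb k) (hφw k)
    simp only [hprod] at h1
    refine le_rpow_of_le_mul_rpow hPQ (integral_nonneg fun x => ?_) (norm_nonneg ℓ) ?_
    · exact Set.indicator_nonneg (fun x _ => by positivity) x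
    · rw [← h1]
      refine (le_abs_self _).trans ((ℓ.le_opNorm _).trans_eq ?_)
      rw [Lp.norm_toLp, (hφw k).eLpNorm_eq_integral_rpow_norm hp0 hp, h1, ENNReal.toReal_ofReal,
        ← hP]
      · simp only [hpow]
      · positivity
  have hfin : ∀ k, ∫⁻ x, (S k).indicator (fun x => ‖g x‖ₑ ^ Q) x ∂μ ≤ ENNReal.ofReal (‖ℓ‖ ^ Q) := by
    intro k
    refine le_trans ?_ (ENNReal.ofReal_le_ofReal (hI k))
    rw [ofReal_integral_eq_lintegral_ofReal]
    · refine lintegral_mono fun x => ?_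
      by_cases hx : x ∈ S k
      · simp only [Set.indicator_of_mem hx]
        rw [← ENNReal.ofReal_rpow_of_nonneg (abs_nonneg _) hPQ.symm.nonneg, Real.enorm_eq_ofReal_abs]
      · simp [hx]
    · have := (hφw k).integrable_norm_rpow hp0 hp
      rw [← hP] at this
      simpa only [hpow] using this
    · exact ae_of_all _ fun x => Set.indicator_nonneg (fun x _ => by positivity) x
  calc ∫⁻ x, ‖g x‖ₑ ^ Q ∂μ
      = ∫⁻ x, liminf (fun k => (S k).indicator (fun x => ‖g x‖ₑ ^ Q) x) atTop ∂μ := by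
        refine lintegral_congr fun x => ?_
        symm
        apply Tendsto.liminf_eq
        refine tendsto_const_nhds.congr' ?_
        obtain ⟨k, hk⟩ := exists_nat_ge (max |g x| (1 / w x))
        filter_upwards [eventually_ge_atTop k] with j hj
        have hj' : (k : ℝ) ≤ j := by exact_mod_cast hj
        rw [Set.indicator_of_mem]
        refine ⟨(le_max_left _ _).trans (hk.trans hj'), ?_⟩
        rw [← div_le_iff₀ (hw0 x)]
        exact (le_max_right _ _).trans (hk.trans hj')
    _ ≤ liminf (fun k => ∫⁻ x, (S k).indicator (fun x => ‖g x‖ₑ ^ Q) x ∂μ) atTop :=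
        lintegral_liminf_le fun k => (hgm.enorm.pow_const _).indicator (hS k)
    _ ≤ ENNReal.ofReal (‖ℓ‖ ^ Q) :=
        (liminf_le_liminf (Eventually.of_forall hfin)).trans_eq (liminf_const _)
    _ < ⊤ := ENNReal.ofReal_lt_top

/-- **Riesz representation** of the dual of `L^p`, for conjugate finite exponents. -/
theorem exists_memLp_forall_dual_eq_integral [SigmaFinite μ] [Fact (1 ≤ p)] (hp : p ≠ ⊤)
    (hq : q ≠ ⊤) [p.HolderConjugate q] (ℓ : StrongDual ℝ (Lp ℝ p μ)) :
    ∃ g : α → ℝ, MemLp g q μ ∧ ∀ f : Lp ℝ p μ, ℓ f = ∫ x, g x * f x ∂μ := by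
  have hPQ : p.toReal.HolderConjugate q.toReal :=
    ENNReal.HolderConjugate.toReal_of_ne_top hp hq
  have hp0 : p ≠ 0 := fun h => hPQ.ne_zero (by simp [h])
  obtain ⟨w, hw0, hwm, hw⟩ := exists_pos_memLp (μ := μ) hp0 hp
  obtain ⟨h, hhm, hh, H⟩ := exists_integrable_forall_dual_indicator_eq hp ℓ hwm hw
  set g : α → ℝ := fun x => h x / w x with hg
  have hgw : ∀ x, g x * w x = h x := fun x => div_mul_cancel₀ _ (hw0 x).ne'
  have hgm : Measurable g := hhm.div hwm
  have H2 : ∀ (φ : α → ℝ) (C : ℝ), Measurable φ → (∀ x, |φ x| ≤ C) →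
      ∀ hφw : MemLp (fun x => φ x * w x) p μ, ℓ (hφw.toLp _) = ∫ x, (g x * w x) * φ x ∂μ := by
    intro φ C hφ hC hφw
    simp only [hgw]
    exact dual_bounded_mul_eq hp ℓ hwm hw hh H hφ hC hφw
  have hgq := memLp_of_dual_bounded_mul_eq hp hq hPQ ℓ hwm hw0 hw hgm H2
  refine ⟨g, hgq, fun f => ?_⟩
  have hfm : Measurable f := (Lp.stronglyMeasurable f).measurable
  have hf := Lp.memLp f
  let S : ℕ → Set α := fun k => {x | |f x| ≤ k ∧ 1 ≤ k * w x}
  have hS : ∀ k, MeasurableSet (S k) := fun k =>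
    (measurableSet_le hfm.abs measurable_const).inter
      (measurableSet_le measurable_const (hwm.const_mul _))
  have hlim : ∀ x, Tendsto (fun k => (S k).indicator f x) atTop (𝓝 (f x)) := by
    intro x
    refine tendsto_const_nhds.congr' ?_
    obtain ⟨k, hk⟩ := exists_nat_ge (max |f x| (1 / w x))
    filter_upwards [eventually_ge_atTop k] with j hj
    have hj' : (k : ℝ) ≤ j := by exact_mod_cast hj
    rw [Set.indicator_of_mem]
    refine ⟨(le_max_left _ _).trans (hk.trans hj'), ?_⟩
    rw [← div_le_iff₀ (hw0 x)]
    exact (le_max_right _ _).trans (hk.trans hj')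
  have hle : ∀ k x, |(S k).indicator f x| ≤ |f x| := fun k x => by
    by_cases hx : x ∈ S k <;> simp [hx]
  have h1 := MemLp.tendsto_toLp_of_dominated (l := atTop) hp (fun k => hf.indicator (hS k)) hf hf
    (fun k => hfm.indicator (hS k)) hfm hle (fun x => le_rfl) hlim
  have h2 := (ℓ.continuous.tendsto _).comp h1
  rw [Lp.toLp_coeFn] at h2
  have h3 : Tendsto (fun k => ∫ x, g x * (S k).indicator f x ∂μ) atTop
      (𝓝 (∫ x, g x * f x ∂μ)) := by
    refine tendsto_integral_of_dominated_convergence (fun x => ‖g x * f x‖) (fun k => ?_)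
      ?_ (fun k => ae_of_all _ fun x => ?_) (ae_of_all _ fun x => (hlim x).const_mul _)
    · exact hgq.1.mul (hf.indicator (hS k)).1
    · exact (hgq.integrable_mul hf).norm
    · rw [norm_mul, norm_mul]
      gcongr
      exact hle k x
  refine tendsto_nhds_unique h2 (h3.congr fun k => ?_)
  have he : ∀ x, (S k).indicator f x = ((S k).indicator f x / w x) * w x := fun x =>
    (div_mul_cancel₀ _ (hw0 x).ne').symm
  have hm : MemLp (fun x => ((S k).indicator f x / w x) * w x) p μ := by
    simpa only [← he] using hf.indicator (hS k)
  have h4 := H2 (fun x => (S k).indicator f x / w x) (k * k) ((hfm.indicator (hS k)).div hwm) ?_ hm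
  · have h5 : hm.toLp _ = (hf.indicator (hS k)).toLp _ :=
      MemLp.toLp_congr _ _ (ae_of_all _ fun x => (he x).symm)
    rw [h5] at h4
    rw [Function.comp_apply, h4]
    refine integral_congr_ae (ae_of_all _ fun x => ?_)
    field_simp [(hw0 x).ne']
  · intro x
    by_cases hx : x ∈ S k
    · have := hw0 x
      rw [Set.indicator_of_mem hx, abs_div, abs_of_pos this, div_le_iff₀ this, mul_assoc]
      exact hx.1.trans (le_mul_of_one_le_right (Nat.cast_nonneg k) hx.2)
    · rw [Set.indicator_of_notMem hx]
      simp only [zero_div, abs_zero]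
      positivity

end LpDual

/-! ### Weak sequential compactness in `L^p(ℝ³, ℝ³)` -/

section WeakCompactness

variable {p q : ℝ≥0∞}

theorem memLp_toLp_of_components {g : Fin 3 → E3 → ℝ} (hg : ∀ i, MemLp (g i) p volume) :
    MemLp (fun x => (WithLp.toLp 2 fun i => g i x : E3)) p volume := by
  have h : (fun x => (WithLp.toLp 2 fun i => g i x : E3)) =
      fun x => ∑ i, g i x • (EuclideanSpace.single i (1 : ℝ) : E3) := by
    ext x j
    fin_cases j <;> simp [Fin.sum_univ_three]
  rw [h]
  refine memLp_finsetSum _ fun i _ => ?_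
  exact (ContinuousLinearMap.toSpanSingleton ℝ
    (EuclideanSpace.single i (1 : ℝ) : E3)).comp_memLp' (hg i)

theorem exists_memLp_forall_vector_dual_eq_integral [Fact (1 ≤ p)] (hp : p ≠ ⊤)
    (hq : q ≠ ⊤) [p.HolderConjugate q] (ℓ : StrongDual ℝ (Lp E3 p (volume : Measure E3))) :
    ∃ g : E3 → E3, MemLp g q volume ∧
      ∀ f : Lp E3 p (volume : Measure E3), ℓ f = ∫ x, inner ℝ (g x) (f x) := by
  let emb : Fin 3 → (Lp ℝ p (volume : Measure E3) →L[ℝ] Lp E3 p (volume : Measure E3)) := fun i =>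
    (ContinuousLinearMap.toSpanSingleton ℝ (EuclideanSpace.single i (1 : ℝ) : E3)).compLpL p volume
  let pr : Fin 3 → (Lp E3 p (volume : Measure E3) →L[ℝ] Lp ℝ p (volume : Measure E3)) := fun i =>
    (EuclideanSpace.proj (𝕜 := ℝ) i : E3 →L[ℝ] ℝ).compLpL p volume
  choose g hg hgℓ using fun i =>
    exists_memLp_forall_dual_eq_integral (μ := (volume : Measure E3)) hp hq (ℓ.comp (emb i))
  refine ⟨fun x => WithLp.toLp 2 fun i => g i x, memLp_toLp_of_components hg, fun f => ?_⟩
  have hpr : ∀ i, pr i f =ᵐ[volume] fun x => f x i := fun i =>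
    ContinuousLinearMap.coeFn_compLpL _ f
  have hsum : f = ∑ i, emb i (pr i f) := by
    apply Lp.ext
    have h1 : ∀ i, emb i (pr i f) =ᵐ[volume] fun x => (f x i) • EuclideanSpace.single i (1 : ℝ) := by
      intro i
      filter_upwards [ContinuousLinearMap.coeFn_compLpL
        (ContinuousLinearMap.toSpanSingleton ℝ (EuclideanSpace.single i (1 : ℝ) : E3)) (pr i f),
        hpr i] with x h2 h3
      rw [h2, h3]
      rfl
    rw [Fin.sum_univ_three]
    filter_upwards [h1 0, h1 1, h1 2, Lp.coeFn_add (emb 0 (pr 0 f) + emb 1 (pr 1 f)) (emb 2 (pr 2 f)),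
      Lp.coeFn_add (emb 0 (pr 0 f)) (emb 1 (pr 1 f))] with x h0 h1 h2 h3 h4
    rw [h3, Pi.add_apply, h4, Pi.add_apply, h0, h1, h2]
    ext j
    fin_cases j <;> simp
  conv_lhs => rw [hsum]
  rw [map_sum]
  calc ∑ i, ℓ (emb i (pr i f)) = ∑ i, ∫ x, g i x * f x i := by
        refine Finset.sum_congr rfl fun i _ => ?_
        rw [← ContinuousLinearMap.comp_apply, hgℓ i]
        refine integral_congr_ae ?_
        filter_upwards [hpr i] with x hx
        rw [hx]
    _ = _ := by
        rw [← integral_finsetSum]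
        · refine integral_congr_ae (ae_of_all _ fun x => ?_)
          simp [PiLp.inner_apply, mul_comm]
        · intro i _
          exact (hg i).integrable_mul (q := p) ((memLp_congr_ae (hpr i)).1 (Lp.memLp _))

theorem exists_subseq_tendsto_dual [Fact (1 ≤ p)] [Fact (1 ≤ q)] (hp : p ≠ ⊤)
    (hq : q ≠ ⊤) [p.HolderConjugate q] {u : ℕ → Lp E3 p (volume : Measure E3)} {C : ℝ}
    (hu : ∀ n, ‖u n‖ ≤ C) :
    ∃ (v : Lp E3 p (volume : Measure E3)) (ns : ℕ → ℕ), StrictMono ns ∧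
      ∀ ℓ : StrongDual ℝ (Lp E3 p (volume : Measure E3)),
        Tendsto (fun k => ℓ (u (ns k))) atTop (𝓝 (ℓ v)) := by
  have : q.HolderConjugate p := ENNReal.HolderConjugate.symm
  have : Fact (q ≠ ⊤) := ⟨hq⟩
  let Φ : Lp E3 p (volume : Measure E3) →L[ℝ] StrongDual ℝ (Lp E3 q (volume : Measure E3)) :=
    (innerSL ℝ (E := E3)).lpPairing volume p q
  have hΦ : ∀ f g, Φ f g = ∫ x, inner ℝ (f x) (g x) := fun f g =>
    ContinuousLinearMap.lpPairing_eq_integral _ f g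
  have hmem : ∀ n, StrongDual.toWeakDual (Φ (u n)) ∈
      WeakDual.toStrongDual ⁻¹' Metric.closedBall (0 : StrongDual ℝ (Lp E3 q (volume : Measure E3)))
        (‖Φ‖ * C) := by
    intro n
    simp only [Set.mem_preimage, mem_closedBall_zero_iff]
    exact (Φ.le_opNorm _).trans (by gcongr; exact hu n)
  obtain ⟨Λ, -, ns, hns, hlim⟩ := WeakDual.isSeqCompact_closedBall ℝ _ _ _ hmem
  obtain ⟨b, hb, hbΛ⟩ := exists_memLp_forall_vector_dual_eq_integral hq hp (WeakDual.toStrongDual Λ)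
  refine ⟨hb.toLp b, ns, hns, fun ℓ => ?_⟩
  obtain ⟨g, hg, hgℓ⟩ := exists_memLp_forall_vector_dual_eq_integral hp hq ℓ
  have h1 : Tendsto (fun k => Φ (u (ns k)) (hg.toLp g)) atTop (𝓝 (Λ (hg.toLp g))) :=
    (WeakDual.eval_continuous (hg.toLp g)).tendsto _ |>.comp hlim
  have h2 : ∀ f : Lp E3 p (volume : Measure E3), ℓ f = ∫ x, inner ℝ (f x) (hg.toLp g x) := by
    intro f
    rw [hgℓ]
    refine integral_congr_ae ?_
    filter_upwards [hg.coeFn_toLp] with x hx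
    rw [hx, real_inner_comm]
  have h3 : Λ (hg.toLp g) = ℓ (hb.toLp b) := by
    rw [h2]
    refine (hbΛ _).trans (integral_congr_ae ?_)
    filter_upwards [hb.coeFn_toLp] with x hx
    rw [hx]
  rw [← h3]
  refine h1.congr fun k => ?_
  rw [h2, hΦ]

end WeakCompactness

/-! ### Averages at a given scale -/

section ScaledAverage

/-- The average `z ↦ ∫ w(x) f(z - t x) dx` of `f` against `w` at scale `t`. -/
noncomputable def scaledAverage (w f : E3 → ℝ) (t : ℝ) (z : E3) : ℝ :=
  ∫ x, w x * f (z - t • x)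

theorem quasiMeasurePreserving_sub_smul {t : ℝ} (ht : t ≠ 0) (z : E3) :
    Measure.QuasiMeasurePreserving (fun x : E3 => z - t • x) volume volume := by
  have h1 : Measure.QuasiMeasurePreserving (fun x : E3 => z - x) volume volume :=
    (Measure.measurePreserving_sub_left volume z).quasiMeasurePreserving
  have h2 : Measure.QuasiMeasurePreserving (fun x : E3 => t • x) volume volume :=
    Measure.quasiMeasurePreserving_smul volume ht
  exact h1.comp h2

theorem scaledAverage_congr_ae {w f g : E3 → ℝ} {t : ℝ} (ht : t ≠ 0) (h : f =ᵐ[volume] g) :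
    scaledAverage w f t = scaledAverage w g t := by
  ext z
  refine integral_congr_ae ?_
  filter_upwards [(quasiMeasurePreserving_sub_smul ht z).ae_eq_comp h] with x hx
  simp only [Function.comp_apply] at hx
  rw [hx]

theorem enorm_scaledAverage_le (w f : E3 → ℝ) (t : ℝ) (z : E3) :
    ‖scaledAverage w f t z‖ₑ ≤ ∫⁻ x, ‖w x‖ₑ * ‖f (z - t • x)‖ₑ := by
  refine (enorm_integral_le_lintegral_enorm _).trans_eq (lintegral_congr fun x => ?_)
  rw [enorm_mul]

theorem measurable_sub_smul (t : ℝ) : Measurable fun q : E3 × E3 => q.1 - t • q.2 := by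
  fun_prop

theorem lintegral_lintegral_mul_sub_smul {w F : E3 → ℝ≥0∞} (hw : Measurable w) (hF : Measurable F)
    (t : ℝ) : ∫⁻ z, ∫⁻ x, w x * F (z - t • x) = (∫⁻ x, w x) * ∫⁻ x, F x := by
  rw [lintegral_lintegral_swap]
  · calc ∫⁻ x, ∫⁻ z, w x * F (z - t • x) = ∫⁻ x, w x * ∫⁻ z, F z := by
          refine lintegral_congr fun x => ?_
          rw [lintegral_const_mul _ (by fun_prop : Measurable fun z => F (z - t • x)),
            lintegral_sub_right_eq_self F]
      _ = _ := lintegral_mul_const _ hw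
  · exact ((hw.comp measurable_snd).mul (hF.comp (measurable_sub_smul t))).aemeasurable

theorem lintegral_mul_pow_three_le {w F : E3 → ℝ≥0∞} (hw : Measurable w) (hF : Measurable F) :
    (∫⁻ x, w x * F x) ^ (3 : ℝ) ≤ (∫⁻ x, w x) ^ (2 : ℝ) * ∫⁻ x, w x * F x ^ (3 : ℝ) := by
  have hc : Real.HolderConjugate 3 (3 / 2) := by
    rw [Real.holderConjugate_iff]; norm_num
  have h := ENNReal.lintegral_mul_le_Lp_mul_Lq volume hc
    (f := fun x => w x ^ (1 / 3 : ℝ) * F x) (g := fun x => w x ^ (2 / 3 : ℝ))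
    ((hw.pow_const _).mul hF).aemeasurable (hw.pow_const _).aemeasurable
  have e1 : ∀ x, w x ^ (1 / 3 : ℝ) * F x * w x ^ (2 / 3 : ℝ) = w x * F x := fun x => by
    rw [mul_right_comm, ← ENNReal.rpow_add_of_nonneg _ _ (by norm_num) (by norm_num)]
    norm_num
  have e2 : ∀ x, (w x ^ (1 / 3 : ℝ) * F x) ^ (3 : ℝ) = w x * F x ^ (3 : ℝ) := fun x => by
    rw [ENNReal.mul_rpow_of_nonneg _ _ (by norm_num), ← ENNReal.rpow_mul]
    norm_num
  have e3 : ∀ x, (w x ^ (2 / 3 : ℝ)) ^ (3 / 2 : ℝ) = w x := fun x => by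
    rw [← ENNReal.rpow_mul]; norm_num
  simp only [Pi.mul_apply, e1, e2, e3] at h
  refine (ENNReal.rpow_le_rpow h (by norm_num : (0 : ℝ) ≤ 3)).trans_eq ?_
  rw [ENNReal.mul_rpow_of_nonneg _ _ (by norm_num), ← ENNReal.rpow_mul, ← ENNReal.rpow_mul, mul_comm]
  norm_num

theorem eLpNorm_three_rpow (f : E3 → ℝ) :
    eLpNorm f 3 volume ^ (3 : ℝ) = ∫⁻ x, ‖f x‖ₑ ^ (3 : ℝ) := by
  rw [eLpNorm_eq_lintegral_rpow_enorm_toReal (by norm_num) (by norm_num), ← ENNReal.rpow_mul]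
  norm_num

/-- Young's inequality for averages. -/
theorem eLpNorm_scaledAverage_le {w f : E3 → ℝ} (hw : Measurable w)
    (hf : AEStronglyMeasurable f volume) {t : ℝ} (ht : t ≠ 0) :
    eLpNorm (scaledAverage w f t) 3 volume ≤ (∫⁻ x, ‖w x‖ₑ) * eLpNorm f 3 volume := by
  obtain ⟨g, hg, hfg⟩ := hf
  rw [scaledAverage_congr_ae ht hfg, eLpNorm_congr_ae hfg]
  have hgm := hg.measurable.enorm
  have hwm := hw.enorm
  rw [← ENNReal.rpow_le_rpow_iff (z := 3) (by norm_num), ENNReal.mul_rpow_of_nonneg _ _ (by norm_num),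
    eLpNorm_three_rpow, eLpNorm_three_rpow]
  calc ∫⁻ z, ‖scaledAverage w g t z‖ₑ ^ (3 : ℝ)
      ≤ ∫⁻ z, (∫⁻ x, ‖w x‖ₑ) ^ (2 : ℝ) * ∫⁻ x, ‖w x‖ₑ * ‖g (z - t • x)‖ₑ ^ (3 : ℝ) := by
        refine lintegral_mono fun z => ?_
        refine (ENNReal.rpow_le_rpow (enorm_scaledAverage_le w g t z) (by norm_num)).trans ?_
        exact lintegral_mul_pow_three_le hwm (hgm.comp (by fun_prop : Measurable fun x => z - t • x))
    _ = (∫⁻ x, ‖w x‖ₑ) ^ (2 : ℝ) * ((∫⁻ x, ‖w x‖ₑ) * ∫⁻ x, ‖g x‖ₑ ^ (3 : ℝ)) := by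
        rw [lintegral_const_mul, lintegral_lintegral_mul_sub_smul hwm (hgm.pow_const _)]
        refine Measurable.lintegral_prod_right' (f := fun q : E3 × E3 =>
          ‖w q.2‖ₑ * ‖g (q.1 - t • q.2)‖ₑ ^ (3 : ℝ)) ?_
        exact (hwm.comp measurable_snd).mul ((hgm.comp (measurable_sub_smul t)).pow_const _)
    _ = _ := by
        rw [← mul_assoc]
        congr 1
        nth_rewrite 2 [← ENNReal.rpow_one (∫⁻ x, ‖w x‖ₑ)]
        rw [← ENNReal.rpow_add_of_nonneg _ _ (by norm_num) (by norm_num)]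
        norm_num

/-- The `L¹`-normalised dilation `x ↦ t⁻³ w(x / t)`. -/
noncomputable def dilate (t : ℝ) (w : E3 → ℝ) (x : E3) : ℝ := (t ^ 3)⁻¹ * w (t⁻¹ • x)

theorem continuous_dilate {w : E3 → ℝ} (hw : Continuous w) (t : ℝ) : Continuous (dilate t w) := by
  unfold dilate
  fun_prop

theorem hasCompactSupport_dilate {w : E3 → ℝ} (hw : HasCompactSupport w) {t : ℝ} (ht : t ≠ 0) :
    HasCompactSupport (dilate t w) :=
  (hw.comp_smul (inv_ne_zero ht)).mul_left

theorem scaledAverage_eq_convolution (w f : E3 → ℝ) {t : ℝ} (ht : 0 < t) :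
    scaledAverage w f t =
      convolution (dilate t w) f (ContinuousLinearMap.mul ℝ ℝ) volume := by
  ext z
  rw [convolution_mul, scaledAverage]
  have h := Measure.integral_comp_smul_of_nonneg (volume : Measure E3)
    (fun x => w (t⁻¹ • x) * f (z - x)) t (hR := ht.le)
  simp only [smul_smul, inv_mul_cancel₀ ht.ne', one_smul] at h
  rw [h, ← integral_smul]
  simp [dilate, smul_eq_mul, mul_assoc]

theorem integrable_mul_comp_sub_smul {w f : E3 → ℝ} (hw : Continuous w) (hws : HasCompactSupport w)
    (hf : LocallyIntegrable f volume) {t : ℝ} (ht : t ≠ 0) (z : E3) :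
    Integrable (fun x => w x * f (z - t • x)) volume := by
  have h := (hasCompactSupport_dilate hws ht).convolutionExists_left
    (ContinuousLinearMap.mul ℝ ℝ) (continuous_dilate hw t) hf z
  have h2 := (h.comp_smul ht).const_mul (t ^ 3)
  refine h2.congr (ae_of_all _ fun x => ?_)
  simp only [dilate, ContinuousLinearMap.mul_apply', smul_smul, inv_mul_cancel₀ ht, one_smul]
  field_simp

theorem continuous_scaledAverage {w f : E3 → ℝ} (hw : Continuous w) (hws : HasCompactSupport w)
    (hf : LocallyIntegrable f volume) {t : ℝ} (ht : 0 < t) :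
    Continuous (scaledAverage w f t) := by
  rw [scaledAverage_eq_convolution w f ht]
  exact (hasCompactSupport_dilate hws ht.ne').continuous_convolution_left _
    (continuous_dilate hw t) hf

theorem scaledAverage_sub {w f g : E3 → ℝ} (hw : Continuous w) (hws : HasCompactSupport w)
    (hf : LocallyIntegrable f volume) (hg : LocallyIntegrable g volume) {t : ℝ} (ht : t ≠ 0) (z : E3) :
    scaledAverage w (f - g) t z = scaledAverage w f t z - scaledAverage w g t z := by
  rw [scaledAverage, scaledAverage, scaledAverage, ← integral_sub
    (integrable_mul_comp_sub_smul hw hws hf ht z) (integrable_mul_comp_sub_smul hw hws hg ht z)]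
  simp [mul_sub]

theorem lintegral_enorm_ne_top_of_hasCompactSupport {w : E3 → ℝ} (hw : Continuous w)
    (hws : HasCompactSupport w) : ∫⁻ x, ‖w x‖ₑ ≠ ⊤ :=
  (hw.integrable_of_hasCompactSupport hws).2.ne

theorem exists_support_subset_closedBall {w : E3 → ℝ} (hws : HasCompactSupport w) :
    ∃ r : ℝ, 0 < r ∧ ∀ x, w x ≠ 0 → ‖x‖ ≤ r := by
  obtain ⟨r, hr, h⟩ := hws.isCompact.isBounded.subset_closedBall_lt 0 0
  exact ⟨r, hr, fun x hx => by simpa using h (subset_tsupport _ hx)⟩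

theorem eventually_eLpNorm_sub_scaledAverage_le_of_continuous {w g : E3 → ℝ} (hw : Continuous w)
    (hws : HasCompactSupport w) (hw1 : ∫ x, w x = 1) (hg : Continuous g)
    (hgs : HasCompactSupport g) {δ : ℝ≥0∞} (hδ : δ ≠ 0) :
    ∀ᶠ t in 𝓝[>] 0, eLpNorm (g - scaledAverage w g t) 3 volume ≤ δ := by
  obtain ⟨r, hr0, hr⟩ := exists_support_subset_closedBall hws
  obtain ⟨R, hR0, hR⟩ := exists_support_subset_closedBall hgs
  set W := ∫ x, ‖w x‖ with hW
  have hW0 : 0 ≤ W := integral_nonneg fun x => norm_nonneg _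
  set V : ℝ≥0∞ := volume (Metric.closedBall (0 : E3) (R + r)) ^ (1 / (3 : ℝ≥0∞).toReal) with hV
  have hVt : V ≠ ⊤ := ENNReal.rpow_ne_top_of_nonneg (by positivity) measure_closedBall_lt_top.ne
  obtain ⟨ε, hε0, hε⟩ : ∃ ε : ℝ, 0 < ε ∧ ENNReal.ofReal (W * ε) * V ≤ δ := by
    have h1 : Tendsto (fun ε : ℝ => ENNReal.ofReal (W * ε) * V) (𝓝[>] 0) (𝓝 0) := by
      have h2 : Tendsto (fun ε : ℝ => W * ε) (𝓝[>] 0) (𝓝 0) := by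
        have : Continuous fun ε : ℝ => W * ε := by fun_prop
        simpa using (this.tendsto 0).mono_left nhdsWithin_le_nhds
      simpa using ENNReal.Tendsto.mul_const (ENNReal.tendsto_ofReal h2) (Or.inr hVt)
    obtain ⟨ε, h3, h4⟩ := ((h1.eventually (Iic_mem_nhds hδ.bot_lt)).and self_mem_nhdsWithin).exists
    exact ⟨ε, h4, h3⟩
  obtain ⟨η, hη0, hη⟩ := Metric.uniformContinuous_iff.1
    (hgs.uniformContinuous_of_continuous hg) ε hε0
  filter_upwards [Ioo_mem_nhdsGT (by positivity : 0 < min 1 (η / (2 * r)))] with t ht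
  have ht0 : 0 < t := ht.1
  have ht1 : t ≤ 1 := ht.2.le.trans (min_le_left _ _)
  have ht2 : t * r < η := by
    have : t * r ≤ η / (2 * r) * r := by gcongr; exact ht.2.le.trans (min_le_right _ _)
    have h2 : η / (2 * r) * r = η / 2 := by field_simp
    linarith
  have hgl := hg.locallyIntegrable (μ := (volume : Measure E3))
  have hpt : ∀ z, ‖g z - scaledAverage w g t z‖ ≤ W * ε := by
    intro z
    have h1 : g z - scaledAverage w g t z = ∫ x, w x * (g z - g (z - t • x)) := by
      simp only [mul_sub]
      rw [integral_sub _ (integrable_mul_comp_sub_smul hw hws hgl ht0.ne' z), integral_mul_const,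
        hw1, one_mul, scaledAverage]
      exact (hw.integrable_of_hasCompactSupport hws).mul_const _
    rw [h1, hW, ← integral_mul_const]
    refine norm_integral_le_of_norm_le ((hw.integrable_of_hasCompactSupport hws).norm.mul_const _)
      (ae_of_all _ fun x => ?_)
    rw [norm_mul]
    by_cases hx : w x = 0
    · simp [hx]
    gcongr
    rw [← dist_eq_norm]
    refine (hη ?_).le
    rw [dist_eq_norm, sub_sub_cancel, norm_smul, Real.norm_of_nonneg ht0.le]
    exact lt_of_le_of_lt (by gcongr; exact hr x hx) ht2
  have hsupp : ∀ z, z ∉ Metric.closedBall (0 : E3) (R + r) → g z - scaledAverage w g t z = 0 := by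
    intro z hz
    rw [mem_closedBall_zero_iff, not_le] at hz
    have hgz : g z = 0 := by
      by_contra h
      linarith [hR z h]
    rw [hgz, scaledAverage, zero_sub, neg_eq_zero]
    refine integral_eq_zero_of_ae (ae_of_all _ fun x => ?_)
    by_contra h
    obtain ⟨h1, h2⟩ := mul_ne_zero_iff.1 h
    have h3 := hr x h1
    have h4 := hR _ h2
    have h5 : ‖z‖ ≤ ‖z - t • x‖ + ‖t • x‖ := by simpa using norm_add_le (z - t • x) (t • x)
    rw [norm_smul, Real.norm_of_nonneg ht0.le] at h5
    nlinarith [norm_nonneg x]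
  refine le_trans (eLpNorm_mono (g := (Metric.closedBall (0 : E3) (R + r)).indicator
    fun _ => W * ε) fun z => ?_) ((eLpNorm_indicator_const_le _ _).trans ?_)
  · by_cases hz : z ∈ Metric.closedBall (0 : E3) (R + r)
    · rw [Set.indicator_of_mem hz, Real.norm_of_nonneg (by positivity : 0 ≤ W * ε)]
      exact hpt z
    · rw [Pi.sub_apply, hsupp z hz]
      simp
  · rwa [Real.enorm_eq_ofReal (by positivity)]

theorem norm_scaledAverage_le_of_bounded {w g : E3 → ℝ} (hg : Integrable g volume) {M : ℝ}
    (hM : ∀ x, ‖w x‖ ≤ M) {t : ℝ} (ht : 0 < t) (z : E3) :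
    ‖scaledAverage w g t z‖ ≤ (t ^ 3)⁻¹ * (M * ∫ x, ‖g x‖) := by
  have h1 : ∫ x, M * ‖g (z - t • x)‖ = (t ^ 3)⁻¹ * (M * ∫ x, ‖g x‖) := by
    rw [Measure.integral_comp_smul_of_nonneg (volume : Measure E3)
      (fun x => M * ‖g (z - x)‖) t (hR := ht.le), integral_const_mul,
      integral_sub_left_eq_self (fun x => ‖g x‖)]
    simp
  rw [← h1]
  refine norm_integral_le_of_norm_le ?_ (ae_of_all _ fun x => ?_)
  · exact (((hg.comp_sub_left z).comp_smul ht.ne').norm).const_mul M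
  · rw [norm_mul]
    gcongr
    exact hM x

theorem eventually_eLpNorm_scaledAverage_le_of_continuous {w g : E3 → ℝ} (hw : Continuous w)
    (hws : HasCompactSupport w) (hg : Continuous g)
    (hgs : HasCompactSupport g) {δ : ℝ≥0∞} (hδ : δ ≠ 0) :
    ∀ᶠ t in atTop, eLpNorm (scaledAverage w g t) 3 volume ≤ δ := by
  obtain ⟨M, hM⟩ := hw.bounded_above_of_compact_support hws
  have hgi := hg.integrable_of_hasCompactSupport (μ := volume) hgs
  set c : ℝ → ℝ := fun t => (t ^ 3)⁻¹ * (M * ∫ x, ‖g x‖) with hc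
  set D : ℝ≥0∞ := (∫⁻ x, ‖w x‖ₑ) * ∫⁻ x, ‖g x‖ₑ with hD
  have hDt : D ≠ ⊤ := ENNReal.mul_ne_top (lintegral_enorm_ne_top_of_hasCompactSupport hw hws)
    (lintegral_enorm_ne_top_of_hasCompactSupport hg hgs)
  have hbound : ∀ t, 0 < t →
      eLpNorm (scaledAverage w g t) 3 volume ^ (3 : ℝ) ≤ ENNReal.ofReal (c t) ^ (2 : ℝ) * D := by
    intro t ht
    have hm : Measurable fun z => ∫⁻ x, ‖w x‖ₑ * ‖g (z - t • x)‖ₑ := by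
      refine Measurable.lintegral_prod_right' (f := fun q : E3 × E3 =>
          ‖w q.2‖ₑ * ‖g (q.1 - t • q.2)‖ₑ) ?_
      exact (hw.measurable.enorm.comp measurable_snd).mul
        (hg.measurable.enorm.comp (measurable_sub_smul t))
    rw [eLpNorm_three_rpow, hD, ← lintegral_lintegral_mul_sub_smul hw.measurable.enorm
      hg.measurable.enorm t, ← lintegral_const_mul _ hm]
    refine lintegral_mono fun z => ?_
    have h1 : ‖scaledAverage w g t z‖ₑ ≤ ENNReal.ofReal (c t) := by
      rw [← ofReal_norm]
      exact ENNReal.ofReal_le_ofReal (norm_scaledAverage_le_of_bounded hgi hM ht z)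
    rw [show (3 : ℝ) = 2 + 1 by norm_num,
      ENNReal.rpow_add_of_nonneg _ _ (by norm_num) (by norm_num), ENNReal.rpow_one]
    gcongr
    exact enorm_scaledAverage_le w g t z
  have hlim : Tendsto (fun t => ENNReal.ofReal (c t) ^ (2 : ℝ) * D) atTop (𝓝 0) := by
    have h1 : Tendsto c atTop (𝓝 0) := by
      have : Tendsto (fun t : ℝ => (t ^ 3)⁻¹) atTop (𝓝 0) :=
        (tendsto_pow_atTop (by norm_num)).inv_tendsto_atTop
      simpa [hc] using this.mul_const (M * ∫ x, ‖g x‖)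
    have h2 : Tendsto (fun t => ENNReal.ofReal (c t)) atTop (𝓝 0) := by
      simpa using ENNReal.tendsto_ofReal h1
    have h3 := (ENNReal.continuous_rpow_const (y := 2)).tendsto 0 |>.comp h2
    simpa [Function.comp_def] using ENNReal.Tendsto.mul_const h3 (Or.inr hDt)
  have hδ3 : 0 < δ ^ (3 : ℝ) := ENNReal.rpow_pos_of_nonneg hδ.bot_lt (by norm_num)
  filter_upwards [hlim.eventually (Iic_mem_nhds hδ3), eventually_gt_atTop 0] with t h1 h2
  rw [← ENNReal.rpow_le_rpow_iff (z := 3) (by norm_num)]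
  exact (hbound t h2).trans h1

theorem exists_continuous_approximation {w f : E3 → ℝ} (hw : Continuous w)
    (hws : HasCompactSupport w) (hf : MemLp f 3 volume) {δ : ℝ≥0∞} (hδ : δ ≠ 0) :
    ∃ g : E3 → ℝ, Continuous g ∧ HasCompactSupport g ∧ eLpNorm (f - g) 3 volume ≤ δ ∧
      ∀ t, 0 < t → eLpNorm (scaledAverage w (f - g) t) 3 volume ≤ δ := by
  have hWt := lintegral_enorm_ne_top_of_hasCompactSupport hw hws
  have h1W : 1 + ∫⁻ x, ‖w x‖ₑ ≠ 0 := by simp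
  have h1Wt : 1 + ∫⁻ x, ‖w x‖ₑ ≠ ⊤ := by simp [hWt]
  have hδ' : δ / (1 + ∫⁻ x, ‖w x‖ₑ) ≠ 0 := ENNReal.div_ne_zero.2 ⟨hδ, h1Wt⟩
  obtain ⟨g, hgs, hfg, hg, hgm⟩ :=
    hf.exists_hasCompactSupport_eLpNorm_sub_le (by norm_num) hδ'
  have h2 : (1 + ∫⁻ x, ‖w x‖ₑ) * eLpNorm (f - g) 3 volume ≤ δ := by
    refine (mul_le_mul_right hfg _).trans_eq ?_
    exact ENNReal.mul_div_cancel h1W h1Wt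
  refine ⟨g, hg, hgs, le_trans ?_ h2, fun t ht => ?_⟩
  · exact le_mul_of_one_le_left zero_le (by simp)
  · refine (eLpNorm_scaledAverage_le hw.measurable (hf.sub hgm).1 ht.ne').trans (le_trans ?_ h2)
    gcongr
    simp

theorem eventually_eLpNorm_sub_scaledAverage_le {w f : E3 → ℝ} (hw : Continuous w)
    (hws : HasCompactSupport w) (hw1 : ∫ x, w x = 1) (hf : MemLp f 3 volume) {δ : ℝ≥0∞}
    (hδ : δ ≠ 0) :
    ∀ᶠ t in 𝓝[>] 0, eLpNorm (f - scaledAverage w f t) 3 volume ≤ δ := by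
  have hδ3 : δ / 3 ≠ 0 := ENNReal.div_ne_zero.2 ⟨hδ, by norm_num⟩
  obtain ⟨g, hg, hgs, h1, h2⟩ := exists_continuous_approximation hw hws hf hδ3
  have hfl := hf.locallyIntegrable (by norm_num)
  have hgl := hg.locallyIntegrable (μ := (volume : Measure E3))
  filter_upwards [eventually_eLpNorm_sub_scaledAverage_le_of_continuous hw hws hw1 hg hgs hδ3,
    self_mem_nhdsWithin] with t h3 (h4 : 0 < t)
  have he : f - scaledAverage w f t =
      (f - g) + (g - scaledAverage w g t) - scaledAverage w (f - g) t := by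
    ext z
    simp only [Pi.sub_apply, Pi.add_apply, scaledAverage_sub hw hws hfl hgl h4.ne' z]
    ring
  have hcf := (continuous_scaledAverage hw hws hgl h4).aestronglyMeasurable (μ := volume)
  have hcd := (continuous_scaledAverage hw hws (hfl.sub hgl) h4).aestronglyMeasurable (μ := volume)
  have hgm := hg.aestronglyMeasurable (μ := volume)
  rw [he]
  calc _ ≤ eLpNorm ((f - g) + (g - scaledAverage w g t)) 3 volume
        + eLpNorm (scaledAverage w (f - g) t) 3 volume :=
        eLpNorm_sub_le ((hf.1.sub hgm).add (hgm.sub hcf)) hcd (by norm_num)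
    _ ≤ (δ / 3 + δ / 3) + δ / 3 := by
        gcongr
        · refine (eLpNorm_add_le (hf.1.sub hgm) (hgm.sub hcf) (by norm_num)).trans ?_
          gcongr
        · exact h2 t h4
    _ = δ := ENNReal.add_thirds δ

theorem eventually_eLpNorm_scaledAverage_le {w f : E3 → ℝ} (hw : Continuous w)
    (hws : HasCompactSupport w) (hf : MemLp f 3 volume) {δ : ℝ≥0∞} (hδ : δ ≠ 0) :
    ∀ᶠ t in atTop, eLpNorm (scaledAverage w f t) 3 volume ≤ δ := by
  have hδ2 : δ / 2 ≠ 0 := ENNReal.div_ne_zero.2 ⟨hδ, by norm_num⟩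
  obtain ⟨g, hg, hgs, h1, h2⟩ := exists_continuous_approximation hw hws hf hδ2
  have hfl := hf.locallyIntegrable (by norm_num)
  have hgl := hg.locallyIntegrable (μ := (volume : Measure E3))
  filter_upwards [eventually_eLpNorm_scaledAverage_le_of_continuous hw hws hg hgs hδ2,
    eventually_gt_atTop 0] with t h3 h4
  have he : scaledAverage w f t = scaledAverage w (f - g) t + scaledAverage w g t := by
    ext z
    simp only [Pi.add_apply, scaledAverage_sub hw hws hfl hgl h4.ne' z]
    ring
  have hcf := (continuous_scaledAverage hw hws hgl h4).aestronglyMeasurable (μ := volume)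
  have hcd := (continuous_scaledAverage hw hws (hfl.sub hgl) h4).aestronglyMeasurable (μ := volume)
  rw [he, ← ENNReal.add_halves δ]
  refine (eLpNorm_add_le hcd hcf (by norm_num)).trans ?_
  gcongr
  exact h2 t h4

end ScaledAverage

/-! ### The endpoint-improved potential estimate -/

section PotentialEstimate

theorem sum_dyadic_lt_le {ε T : ℝ} (hε : 0 < ε) (hT : 0 < T) (n : ℕ) :
    ∑ k ∈ Finset.range n with ε * 2 ^ k < T, ε * 2 ^ k ≤ 2 * T := by
  suffices h : ∑ k ∈ Finset.range n with ε * 2 ^ k < T, ε * 2 ^ k ≤ min (2 * T) (ε * 2 ^ n) from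
    h.trans (min_le_left _ _)
  induction n with
  | zero => simp; exact ⟨hT.le, hε.le⟩
  | succ n ih =>
    have h1 := ih.trans (min_le_left _ _)
    have h2 := ih.trans (min_le_right _ _)
    have h3 : 0 < ε * 2 ^ n := by positivity
    rw [Finset.sum_filter, Finset.sum_range_succ, ← Finset.sum_filter, pow_succ, le_min_iff]
    split_ifs with h <;> constructor <;> nlinarith

theorem sum_inv_dyadic_ge_le {ε T : ℝ} (hε : 0 < ε) (hT : 0 < T) (n : ℕ) :
    ∑ k ∈ Finset.range n with ¬ ε * 2 ^ k < T, (ε * 2 ^ k)⁻¹ ≤ 2 / T := by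
  suffices h : ∑ k ∈ Finset.range n with ¬ ε * 2 ^ k < T, (ε * 2 ^ k)⁻¹ ≤
      max 0 (2 / T - 2 * (ε * 2 ^ n)⁻¹) from
    h.trans (max_le (by positivity) (sub_le_self _ (by positivity)))
  induction n with
  | zero => simp
  | succ n ih =>
    have h3 : 0 < (ε * 2 ^ n)⁻¹ := by positivity
    have h4 : (ε * 2 ^ (n + 1))⁻¹ = (ε * 2 ^ n)⁻¹ / 2 := by
      rw [pow_succ, ← mul_assoc, mul_inv, div_eq_mul_inv]
    rw [Finset.sum_filter, Finset.sum_range_succ, ← Finset.sum_filter, h4]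
    split_ifs with h
    · refine (add_zero _).trans_le (ih.trans (max_le_max le_rfl ?_))
      linarith
    · have h5 : (ε * 2 ^ n)⁻¹ ≤ 1 / T := by
        rw [← one_div]
        exact one_div_le_one_div_of_le hT (not_lt.1 h)
      have h6 : 2 / T = 2 * (1 / T) := by ring
      refine (add_le_add_left ih _).trans ?_
      refine le_trans ?_ (le_max_right _ _)
      rcases max_cases 0 (2 / T - 2 * (ε * 2 ^ n)⁻¹) with ⟨h7, _⟩ | ⟨h7, _⟩ <;> rw [h7] <;> linarith

/-- The part of `|b|` above the level `r`. -/
noncomputable def highPart (b : E3 → ℝ) (r : ℝ) (x : E3) : ℝ≥0∞ :=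
  {x | r < |b x|}.indicator (fun x => ‖b x‖ₑ) x

theorem measurable_highPart {b : E3 → ℝ} (hb : Measurable b) (r : ℝ) :
    Measurable (highPart b r) :=
  hb.enorm.indicator (measurableSet_lt measurable_const hb.abs)

theorem enorm_le_add_highPart (b : E3 → ℝ) (r : ℝ) (x : E3) :
    ‖b x‖ₑ ≤ ENNReal.ofReal r + highPart b r x := by
  by_cases h : r < |b x|
  · have : highPart b r x = ‖b x‖ₑ := Set.indicator_of_mem (s := {x | r < |b x|}) h _
    rw [this]
    exact le_add_self
  · refine le_add_right ?_
    rw [Real.enorm_eq_ofReal_abs]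
    exact ENNReal.ofReal_le_ofReal (not_lt.1 h)

variable {w b : E3 → ℝ} {W s ε : ℝ}

theorem enorm_scaledAverage_le_highPart (hw : Measurable w)
    (hW : ∫⁻ x, ‖w x‖ₑ ≤ ENNReal.ofReal W) {r : ℝ} (hr : 0 ≤ r) (t : ℝ) (z : E3) :
    ‖scaledAverage w b t z‖ₑ ≤
      ENNReal.ofReal (r * W) + ∫⁻ x, ‖w x‖ₑ * highPart b r (z - t • x) := by
  refine (enorm_scaledAverage_le w b t z).trans ?_
  calc ∫⁻ x, ‖w x‖ₑ * ‖b (z - t • x)‖ₑ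
      ≤ ∫⁻ x, (‖w x‖ₑ * ENNReal.ofReal r + ‖w x‖ₑ * highPart b r (z - t • x)) := by
        refine lintegral_mono fun x => ?_
        rw [← mul_add]
        gcongr
        exact enorm_le_add_highPart b r _
    _ = (∫⁻ x, ‖w x‖ₑ) * ENNReal.ofReal r + ∫⁻ x, ‖w x‖ₑ * highPart b r (z - t • x) := by
        rw [lintegral_add_left (hw.enorm.mul_const _), lintegral_mul_const _ hw.enorm]
    _ ≤ _ := by
        rw [ENNReal.ofReal_mul hr, mul_comm]
        gcongr

theorem ofReal_sum_le_add_sum_highPart (hw : Measurable w) (hW0 : 0 < W)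
    (hW : ∫⁻ x, ‖w x‖ₑ ≤ ENNReal.ofReal W) (hs : 0 < s)
    (h : ∀ t, 0 < t → ∀ z, t ^ 2 * |scaledAverage w b t z| ≤ s) (hε : 0 < ε) (n : ℕ)
    {τ : ℝ} (hτ : 0 < τ) (z : E3) :
    ENNReal.ofReal (∑ k ∈ Finset.range n, ε * 2 ^ k * |scaledAverage w b (ε * 2 ^ k) z|) ≤
      ENNReal.ofReal (3 * τ / 4) + ∑ k ∈ Finset.range n with ε * 2 ^ k < 4 * s / τ,
        ENNReal.ofReal (ε * 2 ^ k) *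
          ∫⁻ x, ‖w x‖ₑ * highPart b (τ ^ 2 / (32 * W * s)) (z - (ε * 2 ^ k) • x) := by
  set T := 4 * s / τ with hT
  have hT0 : 0 < T := by positivity
  set r := τ ^ 2 / (32 * W * s) with hr
  have hr0 : 0 ≤ r := by positivity
  rw [← Finset.sum_filter_add_sum_filter_not _ (fun k => ε * 2 ^ k < T), add_comm,
    ENNReal.ofReal_add (Finset.sum_nonneg fun k _ => by positivity)
      (Finset.sum_nonneg fun k _ => by positivity)]
  have hlarge : ∑ k ∈ Finset.range n with ¬ ε * 2 ^ k < T,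
      ε * 2 ^ k * |scaledAverage w b (ε * 2 ^ k) z| ≤ τ / 2 := by
    calc _ ≤ ∑ k ∈ Finset.range n with ¬ ε * 2 ^ k < T, s * (ε * 2 ^ k)⁻¹ := by
          refine Finset.sum_le_sum fun k _ => ?_
          have h1 : 0 < ε * 2 ^ k := by positivity
          rw [← div_eq_mul_inv, le_div_iff₀ h1]
          refine le_trans (le_of_eq ?_) (h _ h1 z)
          ring
      _ ≤ s * (2 / T) := by
          rw [← Finset.mul_sum]
          gcongr
          exact sum_inv_dyadic_ge_le hε hT0 n
      _ = τ / 2 := by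
          rw [hT]
          field_simp
          ring
  have hsmall : ENNReal.ofReal (∑ k ∈ Finset.range n with ε * 2 ^ k < T,
      ε * 2 ^ k * |scaledAverage w b (ε * 2 ^ k) z|) ≤
      ENNReal.ofReal (τ / 4) + ∑ k ∈ Finset.range n with ε * 2 ^ k < T,
        ENNReal.ofReal (ε * 2 ^ k) * ∫⁻ x, ‖w x‖ₑ * highPart b r (z - (ε * 2 ^ k) • x) := by
    rw [ENNReal.ofReal_sum_of_nonneg fun k _ => by positivity]
    calc _ ≤ ∑ k ∈ Finset.range n with ε * 2 ^ k < T, (ENNReal.ofReal (ε * 2 ^ k * (r * W)) +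
          ENNReal.ofReal (ε * 2 ^ k) * ∫⁻ x, ‖w x‖ₑ * highPart b r (z - (ε * 2 ^ k) • x)) := by
          refine Finset.sum_le_sum fun k _ => ?_
          have h1 : 0 ≤ ε * 2 ^ k := by positivity
          rw [ENNReal.ofReal_mul h1, ENNReal.ofReal_mul h1, ← mul_add, ← Real.enorm_eq_ofReal_abs]
          gcongr
          exact enorm_scaledAverage_le_highPart hw hW hr0 _ z
      _ ≤ _ := by
          rw [Finset.sum_add_distrib]
          gcongr
          rw [← ENNReal.ofReal_sum_of_nonneg fun k _ => by positivity, ← Finset.sum_mul]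
          refine ENNReal.ofReal_le_ofReal ?_
          calc _ ≤ 2 * T * (r * W) := by
                gcongr
                exact sum_dyadic_lt_le hε hT0 n
            _ = τ / 4 := by
                rw [hT, hr]
                field_simp
                ring
  calc _ ≤ ENNReal.ofReal (τ / 2) + (ENNReal.ofReal (τ / 4) + _) :=
        add_le_add (ENNReal.ofReal_le_ofReal hlarge) hsmall
    _ = _ := by
        rw [← add_assoc, ← ENNReal.ofReal_add (by positivity) (by positivity)]
        congr 2
        ring

theorem volume_lt_sum_le (hw : Measurable w) (hb : Measurable b) (hW0 : 0 < W)
    (hW : ∫⁻ x, ‖w x‖ₑ ≤ ENNReal.ofReal W) (hs : 0 < s)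
    (h : ∀ t, 0 < t → ∀ z, t ^ 2 * |scaledAverage w b t z| ≤ s) (hε : 0 < ε) (n : ℕ)
    {τ : ℝ} (hτ : 0 < τ) :
    volume {z | τ < ∑ k ∈ Finset.range n, ε * 2 ^ k * |scaledAverage w b (ε * 2 ^ k) z|} *
      ENNReal.ofReal (τ ^ 2) ≤
      ENNReal.ofReal (32 * (s * W)) * ∫⁻ x, highPart b (τ ^ 2 / (32 * W * s)) x := by
  set r := τ ^ 2 / (32 * W * s) with hr
  set T := 4 * s / τ with hT
  have hT0 : 0 < T := by positivity
  set S : E3 → ℝ≥0∞ := fun z => ∑ k ∈ Finset.range n with ε * 2 ^ k < T,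
        ENNReal.ofReal (ε * 2 ^ k) * ∫⁻ x, ‖w x‖ₑ * highPart b r (z - (ε * 2 ^ k) • x) with hS
  have hm : ∀ k, Measurable fun z => ∫⁻ x, ‖w x‖ₑ * highPart b r (z - (ε * 2 ^ k : ℝ) • x) := by
    intro k
    refine Measurable.lintegral_prod_right' (f := fun q : E3 × E3 =>
        ‖w q.2‖ₑ * highPart b r (q.1 - (ε * 2 ^ k : ℝ) • q.2)) ?_
    exact (hw.enorm.comp measurable_snd).mul
      ((measurable_highPart hb r).comp (measurable_sub_smul _))
  have hSm : Measurable S := Finset.measurable_sum _ fun k _ => (hm k).const_mul _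
  have hSi : ∫⁻ z, S z ≤ ENNReal.ofReal (2 * T * W) * ∫⁻ x, highPart b r x := by
    rw [hS, lintegral_finsetSum _ fun k _ => (hm k).const_mul _]
    calc _ = (∑ k ∈ Finset.range n with ε * 2 ^ k < T, ENNReal.ofReal (ε * 2 ^ k)) *
          ((∫⁻ x, ‖w x‖ₑ) * ∫⁻ x, highPart b r x) := by
          rw [Finset.sum_mul]
          refine Finset.sum_congr rfl fun k _ => ?_
          rw [lintegral_const_mul _ (hm k),
            lintegral_lintegral_mul_sub_smul hw.enorm (measurable_highPart hb r)]
      _ ≤ _ := by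
          rw [← ENNReal.ofReal_sum_of_nonneg fun k _ => by positivity, ← mul_assoc,
            ENNReal.ofReal_mul (by positivity)]
          gcongr
          exact sum_dyadic_lt_le hε hT0 n
  have hsub : {z | τ < ∑ k ∈ Finset.range n, ε * 2 ^ k * |scaledAverage w b (ε * 2 ^ k) z|} ⊆
      {z | ENNReal.ofReal (τ / 4) ≤ S z} := by
    intro z hz
    have h1 := ofReal_sum_le_add_sum_highPart hw hW0 hW hs h hε n hτ z
    have h2 : ENNReal.ofReal τ ≤ ENNReal.ofReal (3 * τ / 4) + S z :=
      (ENNReal.ofReal_le_ofReal (le_of_lt hz)).trans h1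
    rw [show τ = 3 * τ / 4 + τ / 4 by ring,
      ENNReal.ofReal_add (by positivity) (by positivity)] at h2
    rw [show 3 * (3 * τ / 4 + τ / 4) / 4 = 3 * τ / 4 by ring] at h2
    exact (ENNReal.add_le_add_iff_left ENNReal.ofReal_ne_top).1 h2
  have hτ4 : ENNReal.ofReal (τ / 4) ≠ 0 := (ENNReal.ofReal_pos.2 (by positivity)).ne'
  calc _ ≤ ((∫⁻ z, S z) / ENNReal.ofReal (τ / 4)) * ENNReal.ofReal (τ ^ 2) := by
        gcongr
        exact (measure_mono hsub).trans
          (meas_ge_le_lintegral_div hSm.aemeasurable hτ4 ENNReal.ofReal_ne_top)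
    _ ≤ ((ENNReal.ofReal (2 * T * W) * ∫⁻ x, highPart b r x) / ENNReal.ofReal (τ / 4)) *
          ENNReal.ofReal (τ ^ 2) := by gcongr
    _ = ENNReal.ofReal (2 * T * W * (τ / 4)⁻¹ * τ ^ 2) * ∫⁻ x, highPart b r x := by
        rw [ENNReal.ofReal_mul (p := 2 * T * W * (τ / 4)⁻¹) (by positivity),
          ENNReal.ofReal_mul (p := 2 * T * W) (by positivity),
          ENNReal.ofReal_inv_of_pos (by positivity), div_eq_mul_inv]
        ring
    _ = _ := by
        congr 2
        rw [hT]
        field_simp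
        ring

theorem lintegral_lintegral_highPart_le (hb : Measurable b) {c : ℝ} (hc : 0 < c) :
    ∫⁻ τ in Set.Ioi (0 : ℝ), ∫⁻ x, highPart b (τ ^ 2 / c) x ≤
      ENNReal.ofReal (√c) * ∫⁻ x, ‖b x‖ₑ ^ (3 / 2 : ℝ) := by
  have hset : MeasurableSet {q : ℝ × E3 | q.1 ^ 2 / c < |b q.2|} :=
    measurableSet_lt (by fun_prop) (by fun_prop)
  have hjoint : Measurable fun q : ℝ × E3 => highPart b (q.1 ^ 2 / c) q.2 :=
    (hb.enorm.comp measurable_snd).indicator hset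
  rw [lintegral_lintegral_swap hjoint.aemeasurable, ← lintegral_const_mul _ (hb.enorm.pow_const _)]
  refine lintegral_mono fun x => ?_
  have hsub : ∀ τ ∈ Set.Ioi (0 : ℝ), highPart b (τ ^ 2 / c) x ≤
      (Set.Ioo 0 (√c * √|b x|)).indicator (fun _ => ‖b x‖ₑ) τ := by
    intro τ hτ
    by_cases h : τ ^ 2 / c < |b x|
    · have h1 : τ ∈ Set.Ioo 0 (√c * √|b x|) := by
        refine ⟨hτ, ?_⟩
        rw [← Real.sqrt_mul hc.le]
        refine Real.lt_sqrt_of_sq_lt ?_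
        rwa [div_lt_iff₀ hc, mul_comm] at h
      rw [Set.indicator_of_mem h1]
      exact Set.indicator_le_self _ _ _
    · have : highPart b (τ ^ 2 / c) x = 0 :=
        Set.indicator_of_notMem (s := {x | τ ^ 2 / c < |b x|}) h _
      rw [this]
      exact zero_le
  calc ∫⁻ τ in Set.Ioi (0 : ℝ), highPart b (τ ^ 2 / c) x
      ≤ ∫⁻ τ in Set.Ioi (0 : ℝ), (Set.Ioo 0 (√c * √|b x|)).indicator (fun _ => ‖b x‖ₑ) τ :=
        setLIntegral_mono' measurableSet_Ioi hsub
    _ ≤ ∫⁻ τ, (Set.Ioo 0 (√c * √|b x|)).indicator (fun _ => ‖b x‖ₑ) τ := setLIntegral_le_lintegral _ _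
    _ = ‖b x‖ₑ * ENNReal.ofReal (√c * √|b x|) := by
        rw [lintegral_indicator measurableSet_Ioo, setLIntegral_const, Real.volume_Ioo, sub_zero]
    _ = ENNReal.ofReal (√c) * ‖b x‖ₑ ^ (3 / 2 : ℝ) := by
        rw [ENNReal.ofReal_mul (by positivity), Real.sqrt_eq_rpow |b x|,
          ← ENNReal.ofReal_rpow_of_nonneg (abs_nonneg _) (by norm_num), ← Real.enorm_eq_ofReal_abs,
          mul_left_comm]
        congr 1
        nth_rewrite 1 [← ENNReal.rpow_one ‖b x‖ₑ]
        rw [← ENNReal.rpow_add_of_nonneg _ _ (by norm_num) (by norm_num)]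
        norm_num

theorem lintegral_sum_scaledAverage_rpow_le (hw : Continuous w) (hws : HasCompactSupport w)
    (hb : LocallyIntegrable b volume) (hW0 : 0 < W)
    (hW : ∫⁻ x, ‖w x‖ₑ ≤ ENNReal.ofReal W) (hs : 0 < s)
    (h : ∀ t, 0 < t → ∀ z, t ^ 2 * |scaledAverage w b t z| ≤ s) (hε : 0 < ε) (n : ℕ) :
    ∫⁻ z, ‖∑ k ∈ Finset.range n, ε * 2 ^ k * scaledAverage w b (ε * 2 ^ k) z‖ₑ ^ (3 : ℝ) ≤
      ENNReal.ofReal (96 * (s * W) * √(32 * W * s)) * ∫⁻ x, ‖b x‖ₑ ^ (3 / 2 : ℝ) := by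
  obtain ⟨g, hg, hbg⟩ := hb.aestronglyMeasurable
  have hgm := hg.measurable
  have hpos : ∀ k : ℕ, 0 < ε * 2 ^ k := fun k => by positivity
  have hav : ∀ t, 0 < t → scaledAverage w b t = scaledAverage w g t := fun t ht =>
    scaledAverage_congr_ae ht.ne' hbg
  have h' : ∀ t, 0 < t → ∀ z, t ^ 2 * |scaledAverage w g t z| ≤ s := fun t ht z => by
    rw [← hav t ht]
    exact h t ht z
  have hbi : ∫⁻ x, ‖b x‖ₑ ^ (3 / 2 : ℝ) = ∫⁻ x, ‖g x‖ₑ ^ (3 / 2 : ℝ) :=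
    lintegral_congr_ae (by filter_upwards [hbg] with x hx; rw [hx])
  set u : E3 → ℝ := fun z =>
    ∑ k ∈ Finset.range n, ε * 2 ^ k * |scaledAverage w g (ε * 2 ^ k) z| with hu
  have hu0 : ∀ z, 0 ≤ u z := fun z => Finset.sum_nonneg fun k _ => by positivity
  have huc : Continuous u := by
    refine continuous_finsetSum _ fun k _ => continuous_const.mul ?_
    rw [← hav _ (hpos k)]
    exact (continuous_scaledAverage hw hws hb (hpos k)).abs
  rw [hbi]
  calc _ ≤ ∫⁻ z, ENNReal.ofReal (u z ^ (3 : ℝ)) := by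
        refine lintegral_mono fun z => ?_
        rw [← ENNReal.ofReal_rpow_of_nonneg (hu0 z) (by norm_num), Real.enorm_eq_ofReal_abs]
        gcongr
        refine (Finset.abs_sum_le_sum_abs _ _).trans (le_of_eq ?_)
        refine Finset.sum_congr rfl fun k _ => ?_
        rw [abs_mul, abs_of_pos (hpos k), hav _ (hpos k)]
    _ = ENNReal.ofReal 3 * ∫⁻ τ in Set.Ioi (0 : ℝ),
          volume {z | τ < u z} * ENNReal.ofReal (τ ^ ((3 : ℝ) - 1)) :=
        lintegral_rpow_eq_lintegral_meas_lt_mul volume (ae_of_all _ hu0)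
          huc.measurable.aemeasurable (by norm_num)
    _ ≤ ENNReal.ofReal 3 * ∫⁻ τ in Set.Ioi (0 : ℝ),
          ENNReal.ofReal (32 * (s * W)) * ∫⁻ x, highPart g (τ ^ 2 / (32 * W * s)) x := by
        gcongr ENNReal.ofReal 3 * ?_
        refine setLIntegral_mono' measurableSet_Ioi fun τ hτ => ?_
        rw [show (3 : ℝ) - 1 = (2 : ℕ) by norm_num, Real.rpow_natCast]
        exact volume_lt_sum_le hw.measurable hgm hW0 hW hs h' hε n hτ
    _ ≤ ENNReal.ofReal 3 * (ENNReal.ofReal (32 * (s * W)) *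
          (ENNReal.ofReal (√(32 * W * s)) * ∫⁻ x, ‖g x‖ₑ ^ (3 / 2 : ℝ))) := by
        rw [lintegral_const_mul' _ _ ENNReal.ofReal_ne_top]
        gcongr
        exact lintegral_lintegral_highPart_le hgm (by positivity)
    _ = _ := by
        rw [← mul_assoc, ← mul_assoc, ← ENNReal.ofReal_mul (by norm_num),
          ← ENNReal.ofReal_mul (by positivity)]
        congr 2
        ring

end PotentialEstimate

/-! ### A smooth kernel whose dilates telescope under the divergence -/

section Kernel

/-- A smooth function on `ℝ³` that equals `|x|⁻³` for `|x|² ≥ 2` and vanishes for `|x| ≤ 1`. -/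
noncomputable def cutInvCube (x : E3) : ℝ := Real.smoothTransition (‖x‖ ^ 2 - 1) * (‖x‖ ^ 3)⁻¹

theorem cutInvCube_eq_zero {x : E3} (hx : ‖x‖ ≤ 1) : cutInvCube x = 0 := by
  have : ‖x‖ ^ 2 - 1 ≤ 0 := by nlinarith [norm_nonneg x]
  rw [cutInvCube, Real.smoothTransition.zero_of_nonpos this, zero_mul]

theorem cutInvCube_eventuallyEq_zero : cutInvCube =ᶠ[𝓝 0] 0 := by
  filter_upwards [Metric.ball_mem_nhds (0 : E3) one_pos] with x hx
  exact cutInvCube_eq_zero (mem_ball_zero_iff.1 hx).le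

theorem cutInvCube_eq_of_le {x : E3} (hx : 2 ≤ ‖x‖ ^ 2) : cutInvCube x = (‖x‖ ^ 3)⁻¹ := by
  rw [cutInvCube, Real.smoothTransition.one_of_one_le (by linarith), one_mul]

theorem contDiff_cutInvCube : ContDiff ℝ ∞ cutInvCube := by
  rw [contDiff_iff_contDiffAt]
  intro x
  by_cases hx : x = 0
  · subst hx
    exact contDiffAt_const.congr_of_eventuallyEq cutInvCube_eventuallyEq_zero
  · have hn : ‖x‖ ≠ 0 := norm_ne_zero_iff.2 hx
    have h1 : ContDiffAt ℝ ∞ (fun x : E3 => ‖x‖) x := contDiffAt_norm ℝ hx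
    unfold cutInvCube
    refine ContDiffAt.mul ?_ ((h1.pow 3).inv (pow_ne_zero 3 hn))
    exact Real.smoothTransition.contDiffAt.comp x ((h1.pow 2).sub contDiffAt_const)

theorem deriv_smoothTransition_nonneg (y : ℝ) : 0 ≤ deriv Real.smoothTransition y :=
  Real.smoothTransition.monotone.deriv_nonneg

theorem fderiv_cutInvCube_self (x : E3) :
    3 * cutInvCube x + fderiv ℝ cutInvCube x x =
      2 * deriv Real.smoothTransition (‖x‖ ^ 2 - 1) * ‖x‖⁻¹ := by
  by_cases hx : x = 0
  · subst hx
    simp [cutInvCube_eq_zero]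
  have hn : 0 < ‖x‖ := norm_pos_iff.2 hx
  have h1 : HasDerivAt (fun s : ℝ => cutInvCube (s • x)) (fderiv ℝ cutInvCube x x) 1 := by
    have h2 : HasFDerivAt cutInvCube (fderiv ℝ cutInvCube x) ((1 : ℝ) • x) := by
      rw [one_smul]
      exact ((contDiff_cutInvCube.differentiable (by simp)) x).hasFDerivAt
    have h3 : HasDerivAt (fun s : ℝ => s • x) x 1 := by
      simpa using (hasDerivAt_id (1 : ℝ)).smul_const x
    exact h2.comp_hasDerivAt 1 h3
  have h4 : HasDerivAt (fun s : ℝ => Real.smoothTransition (s ^ 2 * ‖x‖ ^ 2 - 1) *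
      (s ^ 3 * ‖x‖ ^ 3)⁻¹) (deriv Real.smoothTransition (‖x‖ ^ 2 - 1) * (2 * ‖x‖ ^ 2) * (‖x‖ ^ 3)⁻¹ +
        Real.smoothTransition (‖x‖ ^ 2 - 1) * (-(3 * ‖x‖ ^ 3) / (‖x‖ ^ 3) ^ 2)) 1 := by
    have h5 : HasDerivAt Real.smoothTransition (deriv Real.smoothTransition (‖x‖ ^ 2 - 1))
        ((1 : ℝ) ^ 2 * ‖x‖ ^ 2 - 1) := by
      rw [one_pow, one_mul]
      exact (Real.smoothTransition.contDiff (n := 1).differentiable (by simp) _).hasDerivAt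
    have h6 : HasDerivAt (fun s : ℝ => s ^ 2 * ‖x‖ ^ 2 - 1) (2 * ‖x‖ ^ 2) 1 := by
      simpa using ((hasDerivAt_pow 2 (1 : ℝ)).mul_const (‖x‖ ^ 2)).sub_const 1
    have h7 : HasDerivAt (fun s : ℝ => s ^ 3 * ‖x‖ ^ 3) (3 * ‖x‖ ^ 3) 1 := by
      simpa using (hasDerivAt_pow 3 (1 : ℝ)).mul_const (‖x‖ ^ 3)
    have h8 := (HasDerivAt.comp (h := fun s : ℝ => s ^ 2 * ‖x‖ ^ 2 - 1) (1 : ℝ) h5 h6).mul (h7.inv (by simp [hn.ne']))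
    exact h8.congr_deriv (by simp)
  have h9 : (fun s : ℝ => cutInvCube (s • x)) =ᶠ[𝓝 1] fun s : ℝ =>
      Real.smoothTransition (s ^ 2 * ‖x‖ ^ 2 - 1) * (s ^ 3 * ‖x‖ ^ 3)⁻¹ := by
    filter_upwards [lt_mem_nhds (zero_lt_one : (0 : ℝ) < 1)] with s hs
    rw [cutInvCube, norm_smul, Real.norm_of_nonneg hs.le, mul_pow, mul_pow]
  rw [h1.unique (h4.congr_of_eventuallyEq h9), cutInvCube]
  field_simp
  ring

/-- The field `x ↦ x |x|⁻³`, smoothly cut off near the origin. -/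
noncomputable def cutNewtonField (i : Fin 3) (x : E3) : ℝ := x i * cutInvCube x

theorem contDiff_cutNewtonField (i : Fin 3) : ContDiff ℝ ∞ (cutNewtonField i) := by
  unfold cutNewtonField
  exact (EuclideanSpace.proj (𝕜 := ℝ) i : E3 →L[ℝ] ℝ).contDiff.mul contDiff_cutInvCube

theorem partialDeriv_cutNewtonField (i : Fin 3) (x : E3) :
    partialDeriv i (cutNewtonField i) x =
      cutInvCube x + x i * fderiv ℝ cutInvCube x (EuclideanSpace.single i 1) := by
  have h1 : HasFDerivAt (fun x : E3 => x i) (EuclideanSpace.proj (𝕜 := ℝ) i : E3 →L[ℝ] ℝ) x :=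
    (EuclideanSpace.proj (𝕜 := ℝ) i : E3 →L[ℝ] ℝ).hasFDerivAt
  have h2 : HasFDerivAt cutInvCube (fderiv ℝ cutInvCube x) x :=
    ((contDiff_cutInvCube.differentiable (by simp)) x).hasFDerivAt
  have h3 : HasFDerivAt (cutNewtonField i) _ x := h1.mul h2
  rw [partialDeriv, h3.fderiv]
  simp [add_comm]

/-- The divergence of the cut-off field. -/
noncomputable def cutNewtonDiv (x : E3) : ℝ := ∑ i, partialDeriv i (cutNewtonField i) x

theorem cutNewtonDiv_eq (x : E3) : cutNewtonDiv x =
    2 * deriv Real.smoothTransition (‖x‖ ^ 2 - 1) * ‖x‖⁻¹ := by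
  have hx : x = ∑ i, x i • (EuclideanSpace.single i (1 : ℝ) : E3) := by
    ext j
    fin_cases j <;> simp [Fin.sum_univ_three]
  rw [← fderiv_cutInvCube_self, cutNewtonDiv]
  simp only [partialDeriv_cutNewtonField, Finset.sum_add_distrib]
  congr 1
  · simp
  · conv_rhs => rw [congrArg (fderiv ℝ cutInvCube x) hx, map_sum]
    simp only [map_smul, smul_eq_mul]

theorem contDiff_cutNewtonDiv : ContDiff ℝ ∞ cutNewtonDiv := by
  unfold cutNewtonDiv partialDeriv
  refine ContDiff.sum fun i _ => ?_
  exact ((contDiff_cutNewtonField i).fderiv_right (m := ∞) (by simp)).clm_apply contDiff_const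

theorem hasCompactSupport_cutNewtonDiv : HasCompactSupport cutNewtonDiv := by
  refine HasCompactSupport.intro (isCompact_closedBall (0 : E3) 2) fun x hx => ?_
  have hx' : 2 < ‖x‖ := by simpa using hx
  have h1 : Real.smoothTransition =ᶠ[𝓝 (‖x‖ ^ 2 - 1)] fun _ => 1 := by
    filter_upwards [lt_mem_nhds (by nlinarith : 1 < ‖x‖ ^ 2 - 1)] with y hy
    exact Real.smoothTransition.one_of_one_le hy.le
  rw [cutNewtonDiv_eq, h1.deriv_eq]
  simp

theorem integral_cutNewtonDiv_pos : 0 < ∫ x, cutNewtonDiv x := by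
  have h0 : ∀ x, 0 ≤ cutNewtonDiv x := fun x => by
    rw [cutNewtonDiv_eq]
    have := deriv_smoothTransition_nonneg (‖x‖ ^ 2 - 1)
    positivity
  obtain ⟨c, hc, hd⟩ := exists_deriv_eq_slope Real.smoothTransition zero_lt_one
    (Real.smoothTransition.continuous.continuousOn)
    ((Real.smoothTransition.contDiff (n := 1).differentiable (by simp)).differentiableOn)
  simp only [Real.smoothTransition.one, Real.smoothTransition.zero, sub_zero, div_one] at hd
  refine contDiff_cutNewtonDiv.continuous.integral_pos_of_hasCompactSupport_nonneg_nonzero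
    hasCompactSupport_cutNewtonDiv h0 (x := EuclideanSpace.single 0 (√(1 + c))) ?_
  have hc0 : 0 < 1 + c := by linarith [hc.1]
  rw [cutNewtonDiv_eq]
  have hn : ‖(EuclideanSpace.single 0 (√(1 + c)) : E3)‖ = √(1 + c) := by
    simp [abs_of_nonneg (Real.sqrt_nonneg _)]
  rw [hn, Real.sq_sqrt hc0.le, add_sub_cancel_left, hd]
  have := Real.sqrt_pos.2 hc0
  positivity

theorem partialDeriv_comp_smul {f : E3 → ℝ} (hf : Differentiable ℝ f) (i : Fin 3) (c : ℝ) (x : E3) :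
    partialDeriv i (fun y => f (c • y)) x = c * partialDeriv i f (c • x) := by
  have h1 : HasFDerivAt (fun y : E3 => c • y) (c • ContinuousLinearMap.id ℝ E3) x :=
    (hasFDerivAt_id x).const_smul c
  have h2 := (hf (c • x)).hasFDerivAt.comp x h1
  have h3 : fderiv ℝ (fun y => f (c • y)) x = _ := h2.fderiv
  rw [partialDeriv, partialDeriv, h3]
  simp

theorem partialDeriv_const_mul {f : E3 → ℝ} (hf : Differentiable ℝ f) (i : Fin 3) (c : ℝ) (x : E3) :
    partialDeriv i (fun y => c * f y) x = c * partialDeriv i f x := by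
  rw [partialDeriv, partialDeriv, fderiv_const_mul (hf x)]
  simp

theorem exists_telescoping_kernel : ∃ (ρ : E3 → ℝ) (Ψ : Fin 3 → E3 → ℝ),
    Continuous ρ ∧ HasCompactSupport ρ ∧ ∫ x, ρ x = 1 ∧ (∀ i, IsTestFunction (Ψ i)) ∧
      ∀ x, ∑ i, partialDeriv i (Ψ i) x = ρ x - dilate 2 ρ x := by
  set I := ∫ x, cutNewtonDiv x with hI
  have hI0 : 0 < I := integral_cutNewtonDiv_pos
  have hd : ∀ i, Differentiable ℝ (cutNewtonField i) := fun i =>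
    (contDiff_cutNewtonField i).differentiable (by simp)
  have hds : ∀ i, Differentiable ℝ fun y => cutNewtonField i ((2 : ℝ)⁻¹ • y) := fun i =>
    (hd i).comp (differentiable_id.const_smul (2 : ℝ)⁻¹)
  have hsm : ∀ i, ContDiff ℝ ∞ fun y => cutNewtonField i ((2 : ℝ)⁻¹ • y) := fun i =>
    (contDiff_cutNewtonField i).comp (contDiff_id.const_smul (2 : ℝ)⁻¹)
  refine ⟨fun x => I⁻¹ * cutNewtonDiv x, fun i x => I⁻¹ * (cutNewtonField i x -
    4⁻¹ * cutNewtonField i ((2 : ℝ)⁻¹ • x)), contDiff_cutNewtonDiv.continuous.const_mul _,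
    hasCompactSupport_cutNewtonDiv.mul_left, ?_, fun i => ⟨?_, ?_⟩, fun x => ?_⟩
  · rw [integral_const_mul, ← hI, inv_mul_cancel₀ hI0.ne']
  · exact contDiff_const.mul ((contDiff_cutNewtonField i).sub (contDiff_const.mul (hsm i)))
  · refine HasCompactSupport.intro (isCompact_closedBall (0 : E3) 3) fun x hx => ?_
    have hx' : 3 < ‖x‖ := by simpa using hx
    have hx2 : ‖(2 : ℝ)⁻¹ • x‖ = ‖x‖ / 2 := by
      rw [norm_smul]
      norm_num
      ring
    simp only [cutNewtonField]
    rw [cutInvCube_eq_of_le (by nlinarith),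
      cutInvCube_eq_of_le (by rw [hx2]; nlinarith), hx2]
    simp only [PiLp.smul_apply, smul_eq_mul]
    field_simp
    ring
  · have h1 : ∀ i, partialDeriv i (fun x => I⁻¹ * (cutNewtonField i x -
        4⁻¹ * cutNewtonField i ((2 : ℝ)⁻¹ • x))) x = I⁻¹ * (partialDeriv i (cutNewtonField i) x -
          8⁻¹ * partialDeriv i (cutNewtonField i) ((2 : ℝ)⁻¹ • x)) := by
      intro i
      rw [partialDeriv_const_mul (f := fun x => cutNewtonField i x -
        4⁻¹ * cutNewtonField i ((2 : ℝ)⁻¹ • x)) ((hd i).sub ((hds i).const_mul _))]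
      congr 1
      have h2 : partialDeriv i (fun x => cutNewtonField i x -
        4⁻¹ * cutNewtonField i ((2 : ℝ)⁻¹ • x)) x = partialDeriv i (cutNewtonField i) x -
          partialDeriv i (fun x => 4⁻¹ * cutNewtonField i ((2 : ℝ)⁻¹ • x)) x := by
        rw [partialDeriv, fderiv_fun_sub (hd i x) ((hds i).const_mul _ x)]
        rfl
      rw [h2, partialDeriv_const_mul (hds i), partialDeriv_comp_smul (hd i)]
      ring
    simp only [h1, ← Finset.mul_sum, Finset.sum_sub_distrib, dilate, cutNewtonDiv]
    ring

end Kernel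

/-! ### The homotopy formula for the curl -/

section Homotopy

/-- Convolution of real functions on `ℝ³`. -/
noncomputable abbrev realConv (κ f : E3 → ℝ) : E3 → ℝ :=
  convolution κ f (ContinuousLinearMap.mul ℝ ℝ) volume

theorem IsTestFunction.continuous {η : E3 → ℝ} (h : IsTestFunction η) : Continuous η :=
  h.1.continuous

theorem IsTestFunction.differentiable {η : E3 → ℝ} (h : IsTestFunction η) : Differentiable ℝ η :=
  h.1.differentiable (by simp)

theorem IsTestFunction.partialDeriv {η : E3 → ℝ} (h : IsTestFunction η) (i : Fin 3) :
    IsTestFunction (partialDeriv i η) := by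
  refine ⟨?_, (h.2.fderiv (𝕜 := ℝ)).mono' fun x hx => subset_tsupport _ fun h0 => hx ?_⟩
  · unfold _root_.partialDeriv
    exact (h.1.fderiv_right (m := ∞) (by simp)).clm_apply contDiff_const
  · simp [_root_.partialDeriv, h0]

theorem IsTestFunction.comp_sub_left {η : E3 → ℝ} (h : IsTestFunction η) (z : E3) :
    IsTestFunction fun y => η (z - y) :=
  ⟨h.1.comp (contDiff_const.sub contDiff_id), h.2.comp_homeomorph (Homeomorph.subLeft z)⟩

theorem IsTestFunction.sum {ι : Type*} {s : Finset ι} {η : ι → E3 → ℝ}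
    (h : ∀ i ∈ s, IsTestFunction (η i)) : IsTestFunction fun x => ∑ i ∈ s, η i x := by
  classical
  induction s using Finset.induction_on with
  | empty => exact ⟨by simpa using contDiff_const, HasCompactSupport.zero⟩
  | insert a s ha ih =>
    simp only [Finset.sum_insert ha]
    have h1 := h a (Finset.mem_insert_self a s)
    have h2 := ih fun i hi => h i (Finset.mem_insert_of_mem hi)
    exact ⟨h1.1.add h2.1, h1.2.add h2.2⟩

theorem IsTestFunction.const_mul {η : E3 → ℝ} (h : IsTestFunction η) (c : ℝ) :
    IsTestFunction fun x => c * η x :=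
  ⟨contDiff_const.mul h.1, h.2.mul_left⟩

theorem IsTestFunction.dilate {η : E3 → ℝ} (h : IsTestFunction η) {t : ℝ} (ht : t ≠ 0) :
    IsTestFunction (dilate t η) :=
  ⟨contDiff_const.mul (h.1.comp (contDiff_id.const_smul t⁻¹)), hasCompactSupport_dilate h.2 ht⟩

theorem partialDeriv_comp_sub_left {η : E3 → ℝ} (h : IsTestFunction η) (z y : E3) (i : Fin 3) :
    partialDeriv i (fun y => η (z - y)) y = -partialDeriv i η (z - y) := by
  have h1 : HasFDerivAt (fun y : E3 => z - y) (-ContinuousLinearMap.id ℝ E3) y :=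
    (hasFDerivAt_id y).const_sub z
  have h2 := (h.differentiable (z - y)).hasFDerivAt.comp y h1
  have h3 : fderiv ℝ (fun y => η (z - y)) y = _ := h2.fderiv
  rw [partialDeriv, partialDeriv, h3]
  simp

theorem MeasureTheory.LocallyIntegrable.component {A : E3 → E3} (hA : LocallyIntegrable A volume) (i : Fin 3) :
    LocallyIntegrable (fun x => A x i) volume := fun x => by
  obtain ⟨s, hs, h⟩ := hA x
  exact ⟨s, hs, (EuclideanSpace.proj (𝕜 := ℝ) i : E3 →L[ℝ] ℝ).integrable_comp h⟩

theorem integrable_conv_swap {κ f : E3 → ℝ} (hκ : IsTestFunction κ)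
    (hf : LocallyIntegrable f volume) (z : E3) :
    Integrable (fun y => κ (z - y) * f y) volume := by
  have h := hκ.2.convolutionExists_left (ContinuousLinearMap.mul ℝ ℝ) hκ.continuous hf z
  simpa using convolutionExistsAt_iff_integrable_swap.1 h

theorem conv_curl {A B : E3 → E3} (h : HasWeakCurl A B) {κ : E3 → ℝ} (hκ : IsTestFunction κ)
    (i : Fin 3) (z : E3) :
    realConv κ (fun x => B x i) z = realConv (partialDeriv (i + 1) κ) (fun x => A x (i + 2)) z -
      realConv (partialDeriv (i + 2) κ) (fun x => A x (i + 1)) z := by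
  rw [realConv, realConv, realConv, convolution_mul_swap, convolution_mul_swap, convolution_mul_swap,
    h.2.2 _ (hκ.comp_sub_left z) i, ← integral_neg, ← integral_sub
      (integrable_conv_swap (hκ.partialDeriv _) (LocallyIntegrable.component h.1 _) z)
      (integrable_conv_swap (hκ.partialDeriv _) (LocallyIntegrable.component h.1 _) z)]
  refine integral_congr_ae (ae_of_all _ fun y => ?_)
  simp only [partialDeriv_comp_sub_left hκ]
  ring

theorem contDiff_conv {κ f : E3 → ℝ} (hκ : IsTestFunction κ) (hf : LocallyIntegrable f volume) :
    ContDiff ℝ ∞ (realConv κ f) :=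
  hκ.2.contDiff_convolution_left _ hκ.1 hf

theorem partialDeriv_conv {κ f : E3 → ℝ} (hκ : IsTestFunction κ)
    (hf : LocallyIntegrable f volume) (j : Fin 3) (z : E3) :
    partialDeriv j (realConv κ f) z = realConv (partialDeriv j κ) f z := by
  have h1 := hκ.2.hasFDerivAt_convolution_right (μ := volume)
    (ContinuousLinearMap.mul ℝ ℝ).flip hf (hκ.1.of_le (by simp)) z
  rw [convolution_flip] at h1
  rw [partialDeriv, h1.fderiv, convolution_precompR_apply _ hf (hκ.2.fderiv (𝕜 := ℝ))
    (hκ.1.continuous_fderiv (by simp)), convolution_flip]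
  rfl

theorem hasWeakGradient_of_contDiff {φ : E3 → ℝ} (hφ : ContDiff ℝ ∞ φ) {G : E3 → E3}
    (hG : ∀ x j, G x j = partialDeriv j φ x) : HasWeakGradient φ G := by
  have hp : ∀ j, Continuous (partialDeriv j φ) := fun j => by
    unfold partialDeriv
    exact (hφ.continuous_fderiv (by simp)).clm_apply continuous_const
  refine ⟨hφ.continuous.locallyIntegrable, ?_, fun η hη j => ?_⟩
  · refine Continuous.locallyIntegrable ?_
    have : G = fun x => WithLp.toLp 2 fun j => partialDeriv j φ x := by
      ext x j
      exact hG x j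
    rw [this]
    exact (PiLp.continuous_toLp 2 _).comp (continuous_pi hp)
  · simp only [hG]
    have hη' := hη.partialDeriv j
    refine integral_mul_fderiv_eq_neg_fderiv_mul_of_integrable ?_ ?_ ?_ ?_ ?_
    · exact (hη'.continuous.mul hφ.continuous).integrable_of_hasCompactSupport hη'.2.mul_right
    · exact (hη.continuous.mul (hp j)).integrable_of_hasCompactSupport hη.2.mul_right
    · exact (hη.continuous.mul hφ.continuous).integrable_of_hasCompactSupport hη.2.mul_right
    · exact fun x _ => hη.differentiable x
    · exact fun x _ => hφ.differentiable (by simp) x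

theorem dilate_one (κ : E3 → ℝ) : dilate 1 κ = κ := by
  ext x
  simp [dilate]

theorem memLp_conv {κ f : E3 → ℝ} (hκ : IsTestFunction κ) (hf : MemLp f 3 volume) :
    MemLp (realConv κ f) 3 volume := by
  have hl := hf.locallyIntegrable (by norm_num)
  refine ⟨(contDiff_conv hκ hl).continuous.aestronglyMeasurable, ?_⟩
  have h1 := scaledAverage_eq_convolution κ f zero_lt_one
  rw [dilate_one] at h1
  rw [realConv, ← h1]
  refine (eLpNorm_scaledAverage_le hκ.continuous.measurable hf.1 one_ne_zero).trans_lt ?_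
  exact ENNReal.mul_lt_top
    (lintegral_enorm_ne_top_of_hasCompactSupport hκ.continuous hκ.2).lt_top hf.2

theorem MeasureTheory.MemLp.component {A : E3 → E3} {p : ℝ≥0∞} (hA : MemLp A p volume) (i : Fin 3) :
    MemLp (fun x => A x i) p volume :=
  (EuclideanSpace.proj (𝕜 := ℝ) i : E3 →L[ℝ] ℝ).comp_memLp' hA

theorem eLpNorm_le_sum_component {F : E3 → E3} (hF : MemLp F 3 volume) :
    eLpNorm F 3 volume ≤ ∑ j, eLpNorm (fun x => F x j) 3 volume := by
  have h : F = ∑ j, fun x => F x j • (EuclideanSpace.single j (1 : ℝ) : E3) := by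
    ext x j
    fin_cases j <;> simp [Fin.sum_univ_three]
  have hj : ∀ j, AEStronglyMeasurable (fun x => F x j) volume := fun j => (MemLp.component hF j).1
  conv_lhs => rw [h]
  refine (eLpNorm_sum_le (fun j _ => (hj j).smul_const _) (by norm_num)).trans ?_
  refine Finset.sum_le_sum fun j _ => eLpNorm_mono fun x => ?_
  simp [norm_smul]

theorem conv_sum_left {ι : Type*} {s : Finset ι} {κ : ι → E3 → ℝ} {f : E3 → ℝ}
    (hκ : ∀ i ∈ s, IsTestFunction (κ i)) (hf : LocallyIntegrable f volume) (z : E3) :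
    realConv (fun x => ∑ i ∈ s, κ i x) f z = ∑ i ∈ s, realConv (κ i) f z := by
  simp only [realConv, convolution_mul_swap, Finset.sum_mul]
  exact integral_finsetSum _ fun i hi => integrable_conv_swap (hκ i hi) hf z

theorem sum_conv_partialDeriv_eq {A B : E3 → E3} (h : HasWeakCurl A B) {K : Fin 3 → E3 → ℝ}
    (hK : ∀ i, IsTestFunction (K i)) (j : Fin 3) (z : E3) :
    realConv (fun x => ∑ i, partialDeriv i (K i) x) (fun x => A x j) z =
      ∑ i, realConv (partialDeriv j (K i)) (fun x => A x i) z +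
        (realConv (K (j + 2)) (fun x => B x (j + 1)) z - realConv (K (j + 1)) (fun x => B x (j + 2)) z) := by
  rw [conv_sum_left (fun i _ => (hK i).partialDeriv i) (LocallyIntegrable.component h.1 j),
    conv_curl h (hK _), conv_curl h (hK _), Fin.sum_univ_three, Fin.sum_univ_three]
  fin_cases j
  · simp
    ring
  · simp
    ring
  · simp
    ring

theorem modGradNorm_le {A B : E3 → E3} (hA : MemLp A 3 volume) (h : HasWeakCurl A B)
    {K : Fin 3 → E3 → ℝ} (hK : ∀ i, IsTestFunction (K i)) :
    modGradNorm A ≤ ∑ j, (eLpNorm ((fun x => A x j) -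
        realConv (fun x => ∑ i, partialDeriv i (K i) x) (fun x => A x j)) 3 volume +
      (eLpNorm (realConv (K (j + 2)) fun x => B x (j + 1)) 3 volume +
        eLpNorm (realConv (K (j + 1)) fun x => B x (j + 2)) 3 volume)) := by
  have hAl := fun i => LocallyIntegrable.component h.1 i
  have hBl := fun i => LocallyIntegrable.component h.2.1 i
  set φ : E3 → ℝ := fun z => ∑ i, realConv (K i) (fun x => A x i) z with hφ
  have hφc : ContDiff ℝ ∞ φ := ContDiff.sum fun i _ => contDiff_conv (hK i) (hAl i)
  set G : E3 → E3 := fun z => WithLp.toLp 2 fun j =>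
    ∑ i, realConv (partialDeriv j (K i)) (fun x => A x i) z with hG
  have hGφ : ∀ x j, G x j = partialDeriv j φ x := by
    intro x j
    rw [partialDeriv, hφ, fderiv_fun_sum fun i _ =>
      (contDiff_conv (hK i) (hAl i)).differentiable (by simp) x]
    simp only [hG, sum_apply]
    exact Finset.sum_congr rfl fun i _ => (partialDeriv_conv (hK i) (hAl i) j x).symm
  have hGm : MemLp G 3 volume := memLp_toLp_of_components fun j =>
    memLp_finsetSum _ fun i _ => memLp_conv ((hK i).partialDeriv j) (MemLp.component hA i)
  have h1 : modGradNorm A ≤ eLpNorm (fun x => A x - G x) 3 volume :=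
    sInf_le ⟨φ, G, hasWeakGradient_of_contDiff hφc hGφ, hGm, rfl⟩
  refine h1.trans ((eLpNorm_le_sum_component (hA.sub hGm)).trans (Finset.sum_le_sum fun j _ => ?_))
  have hD : IsTestFunction fun x => ∑ i, partialDeriv i (K i) x :=
    IsTestFunction.sum fun i _ => (hK i).partialDeriv i
  have h2 : (fun x => (A x - G x) j) = ((fun x => A x j) -
        realConv (fun x => ∑ i, partialDeriv i (K i) x) (fun x => A x j)) +
      ((realConv (K (j + 2)) fun x => B x (j + 1)) - (realConv (K (j + 1)) fun x => B x (j + 2))) := by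
    ext z
    simp only [Pi.add_apply, Pi.sub_apply]
    rw [sum_conv_partialDeriv_eq h hK j z]
    simp only [hG, PiLp.sub_apply]
    ring
  have hm1 := (contDiff_conv hD (hAl j)).continuous.aestronglyMeasurable (μ := volume)
  have hm2 := (contDiff_conv (hK (j + 2)) (hBl (j + 1))).continuous.aestronglyMeasurable (μ := volume)
  have hm3 := (contDiff_conv (hK (j + 1)) (hBl (j + 2))).continuous.aestronglyMeasurable (μ := volume)
  have h3 : (fun x => (A - G) x j) = fun x => (A x - G x) j := rfl
  rw [h3, h2]
  refine (eLpNorm_add_le ((hAl j).aestronglyMeasurable.sub hm1) (hm2.sub hm3) (by norm_num)).trans ?_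
  gcongr
  exact eLpNorm_sub_le hm2 hm3 (by norm_num)

end Homotopy

/-! ### Concentration of the curl at some scale -/

section Concentration

/-- The kernel `∑_{k<n} ε2^k · (Ψ at scale ε2^k)`. -/
noncomputable def dyadicKernel (Ψ : E3 → ℝ) (ε : ℝ) (n : ℕ) (x : E3) : ℝ :=
  ∑ k ∈ Finset.range n, ε * 2 ^ k * dilate (ε * 2 ^ k) Ψ x

theorem isTestFunction_dyadicKernel {Ψ : E3 → ℝ} (hΨ : IsTestFunction Ψ) {ε : ℝ} (hε : 0 < ε)
    (n : ℕ) : IsTestFunction (dyadicKernel Ψ ε n) :=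
  IsTestFunction.sum fun k _ => (hΨ.dilate (by positivity)).const_mul _

theorem conv_dyadicKernel {Ψ f : E3 → ℝ} (hΨ : IsTestFunction Ψ)
    (hf : LocallyIntegrable f volume) {ε : ℝ} (hε : 0 < ε) (n : ℕ) (z : E3) :
    realConv (dyadicKernel Ψ ε n) f z =
      ∑ k ∈ Finset.range n, ε * 2 ^ k * scaledAverage Ψ f (ε * 2 ^ k) z := by
  unfold dyadicKernel
  rw [conv_sum_left (fun k _ => (hΨ.dilate (by positivity)).const_mul _) hf]
  refine Finset.sum_congr rfl fun k _ => ?_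
  rw [scaledAverage_eq_convolution Ψ f (by positivity : 0 < ε * 2 ^ k), realConv, convolution_mul,
    convolution_mul, ← integral_const_mul]
  simp only [mul_assoc]

theorem partialDeriv_mul_dilate {Ψ : E3 → ℝ} (hΨ : IsTestFunction Ψ) {t : ℝ} (ht : t ≠ 0)
    (i : Fin 3) (x : E3) :
    partialDeriv i (fun x => t * dilate t Ψ x) x = dilate t (partialDeriv i Ψ) x := by
  have hd : Differentiable ℝ fun y => Ψ (t⁻¹ • y) :=
    hΨ.differentiable.comp (differentiable_id.const_smul t⁻¹)
  unfold dilate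
  rw [partialDeriv_const_mul (hd.const_mul _), partialDeriv_const_mul hd,
    partialDeriv_comp_smul hΨ.differentiable]
  field_simp

theorem sum_partialDeriv_dyadicKernel {ρ : E3 → ℝ} {Ψ : Fin 3 → E3 → ℝ}
    (hΨ : ∀ i, IsTestFunction (Ψ i))
    (hdiv : ∀ x, ∑ i, partialDeriv i (Ψ i) x = ρ x - dilate 2 ρ x) {ε : ℝ} (hε : 0 < ε) (n : ℕ)
    (x : E3) : ∑ i, partialDeriv i (dyadicKernel (Ψ i) ε n) x =
      dilate ε ρ x - dilate (ε * 2 ^ n) ρ x := by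
  have hpos : ∀ k : ℕ, ε * 2 ^ k ≠ 0 := fun k => by positivity
  have h1 : ∀ i, partialDeriv i (dyadicKernel (Ψ i) ε n) x =
      ∑ k ∈ Finset.range n, dilate (ε * 2 ^ k) (partialDeriv i (Ψ i)) x := by
    intro i
    unfold dyadicKernel
    rw [partialDeriv, fderiv_fun_sum fun k _ =>
      (((hΨ i).dilate (hpos k)).const_mul _).differentiable x, sum_apply]
    exact Finset.sum_congr rfl fun k _ => partialDeriv_mul_dilate (hΨ i) (hpos k) i x
  simp only [h1]
  rw [Finset.sum_comm]
  have h2 : ∀ k, ∑ i, dilate (ε * 2 ^ k) (partialDeriv i (Ψ i)) x =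
      dilate (ε * 2 ^ k) ρ x - dilate (ε * 2 ^ (k + 1)) ρ x := by
    intro k
    simp only [dilate, ← Finset.mul_sum, hdiv, smul_smul]
    rw [mul_sub, ← mul_assoc, ← mul_inv, ← mul_inv]
    congr 3
    · ring
    · congr 2
      ring
  simp only [h2]
  rw [Finset.sum_range_sub']
  simp

theorem conv_sum_partialDeriv_dyadicKernel {ρ f : E3 → ℝ} {Ψ : Fin 3 → E3 → ℝ}
    (hρ : Continuous ρ) (hρs : HasCompactSupport ρ)
    (hΨ : ∀ i, IsTestFunction (Ψ i))
    (hdiv : ∀ x, ∑ i, partialDeriv i (Ψ i) x = ρ x - dilate 2 ρ x)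
    (hf : LocallyIntegrable f volume) {ε : ℝ} (hε : 0 < ε) (n : ℕ) :
    realConv (fun x => ∑ i, partialDeriv i (dyadicKernel (Ψ i) ε n) x) f =
      scaledAverage ρ f ε - scaledAverage ρ f (ε * 2 ^ n) := by
  have hpos : 0 < ε * 2 ^ n := by positivity
  ext z
  have h1 := (hasCompactSupport_dilate hρs hε.ne').convolutionExists_left
    (ContinuousLinearMap.mul ℝ ℝ) (continuous_dilate hρ ε) hf z
  have h2 := (hasCompactSupport_dilate hρs hpos.ne').convolutionExists_left
    (ContinuousLinearMap.mul ℝ ℝ) (continuous_dilate hρ (ε * 2 ^ n)) hf z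
  simp only [sum_partialDeriv_dyadicKernel hΨ hdiv hε n]
  rw [Pi.sub_apply, scaledAverage_eq_convolution ρ f hε, scaledAverage_eq_convolution ρ f hpos,
    realConv, convolution_mul, convolution_mul, convolution_mul]
  simp only [sub_mul]
  exact integral_sub h1 h2

theorem lintegral_component_rpow_le {B : E3 → E3} {C : ℝ≥0∞}
    (hC : eLpNorm B (3 / 2) volume ≤ C) (l : Fin 3) :
    ∫⁻ x, ‖B x l‖ₑ ^ (3 / 2 : ℝ) ≤ C ^ (3 / 2 : ℝ) := by
  have h0 : (3 / 2 : ℝ≥0∞) ≠ 0 := by simp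
  have ht : (3 / 2 : ℝ≥0∞) ≠ ⊤ := ENNReal.div_ne_top (by simp) (by simp)
  have h1 : eLpNorm (fun x => B x l) (3 / 2) volume ≤ C :=
    (eLpNorm_mono fun x => PiLp.norm_apply_le (B x) l).trans hC
  rw [eLpNorm_eq_lintegral_rpow_enorm_toReal h0 ht] at h1
  have h2 := ENNReal.rpow_le_rpow h1 (by norm_num : (0 : ℝ) ≤ 3 / 2)
  rw [← ENNReal.rpow_mul] at h2
  simpa using h2

theorem exists_scale_lt_scaledAverage {ρ : E3 → ℝ} {Ψ : Fin 3 → E3 → ℝ}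
    (hρ : Continuous ρ) (hρs : HasCompactSupport ρ) (hρ1 : ∫ x, ρ x = 1)
    (hΨ : ∀ i, IsTestFunction (Ψ i))
    (hdiv : ∀ x, ∑ i, partialDeriv i (Ψ i) x = ρ x - dilate 2 ρ x) (C : ℝ≥0) :
    ∃ s : ℝ, 0 < s ∧ ∀ A B : E3 → E3, MemLp A 3 volume → HasWeakCurl A B → modGradNorm A = 1 →
      eLpNorm B (3 / 2) volume ≤ C →
      ∃ (i l : Fin 3) (t : ℝ) (z : E3), 0 < t ∧
        s < t ^ 2 * |scaledAverage (Ψ i) (fun x => B x l) t z| := by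
  set W : ℝ := (∑ i, ∫⁻ x, ‖Ψ i x‖ₑ).toReal + 1 with hWdef
  have hW0 : 0 < W := by positivity
  have hW : ∀ i, ∫⁻ x, ‖Ψ i x‖ₑ ≤ ENNReal.ofReal W := by
    intro i
    have hfin : ∑ i, ∫⁻ x, ‖Ψ i x‖ₑ ≠ ⊤ := (ENNReal.sum_lt_top.2 fun i _ =>
      (lintegral_enorm_ne_top_of_hasCompactSupport (hΨ i).continuous (hΨ i).2).lt_top).ne
    calc ∫⁻ x, ‖Ψ i x‖ₑ ≤ ∑ i, ∫⁻ x, ‖Ψ i x‖ₑ :=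
          Finset.single_le_sum (f := fun i => ∫⁻ x, ‖Ψ i x‖ₑ) (fun _ _ => zero_le)
            (Finset.mem_univ i)
      _ = ENNReal.ofReal (∑ i, ∫⁻ x, ‖Ψ i x‖ₑ).toReal := (ENNReal.ofReal_toReal hfin).symm
      _ ≤ ENNReal.ofReal W := ENNReal.ofReal_le_ofReal (by rw [hWdef]; linarith)
  set δ : ℝ≥0∞ := 20⁻¹ with hδ
  have hδ0 : δ ≠ 0 := by simp [hδ]
  obtain ⟨s, hs0, hs⟩ : ∃ s : ℝ, 0 < s ∧
      ENNReal.ofReal (96 * (s * W) * √(32 * W * s)) * (C : ℝ≥0∞) ^ (3 / 2 : ℝ) ≤ δ ^ (3 : ℝ) := by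
    have hCt : (C : ℝ≥0∞) ^ (3 / 2 : ℝ) ≠ ⊤ :=
      ENNReal.rpow_ne_top_of_nonneg (by norm_num) ENNReal.coe_ne_top
    have h1 : Tendsto (fun s : ℝ => ENNReal.ofReal (96 * (s * W) * √(32 * W * s)) *
        (C : ℝ≥0∞) ^ (3 / 2 : ℝ)) (𝓝[>] 0) (𝓝 0) := by
      have h2 : Tendsto (fun s : ℝ => 96 * (s * W) * √(32 * W * s)) (𝓝[>] 0) (𝓝 0) := by
        have : Continuous fun s : ℝ => 96 * (s * W) * √(32 * W * s) := by fun_prop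
        simpa using (this.tendsto 0).mono_left nhdsWithin_le_nhds
      simpa using ENNReal.Tendsto.mul_const (ENNReal.tendsto_ofReal h2) (Or.inr hCt)
    have h3 : 0 < δ ^ (3 : ℝ) := ENNReal.rpow_pos_of_nonneg hδ0.bot_lt (by norm_num)
    obtain ⟨s, h4, h5⟩ := ((h1.eventually (Iic_mem_nhds h3)).and self_mem_nhdsWithin).exists
    exact ⟨s, h5, h4⟩
  refine ⟨s, hs0, fun A B hA hcurl hnorm hC => ?_⟩
  by_contra! hcon
  have hBl := fun l => hcurl.2.1.component l
  have hAl := fun l => hcurl.1.component l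
  obtain ⟨ε, hε1, hε0⟩ := ((eventually_all.2 fun j => eventually_eLpNorm_sub_scaledAverage_le hρ hρs
    hρ1 (hA.component j) hδ0).and self_mem_nhdsWithin).exists
  replace hε0 : 0 < ε := hε0
  have hlarge : ∀ᶠ n : ℕ in atTop, ∀ j : Fin 3,
      eLpNorm (scaledAverage ρ (fun x => A x j) (ε * 2 ^ n)) 3 volume ≤ δ := by
    have h1 : Tendsto (fun n : ℕ => ε * 2 ^ n) atTop atTop :=
      (tendsto_pow_atTop_atTop_of_one_lt one_lt_two).const_mul_atTop hε0
    exact h1.eventually (eventually_all.2 fun j => eventually_eLpNorm_scaledAverage_le hρ hρs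
      (hA.component j) hδ0)
  obtain ⟨n, hn⟩ := hlarge.exists
  have hmain := modGradNorm_le hA hcurl fun i => isTestFunction_dyadicKernel (hΨ i) hε0 n
  have hpot : ∀ i l, eLpNorm (realConv (dyadicKernel (Ψ i) ε n) fun x => B x l) 3 volume ≤ δ := by
    intro i l
    rw [← ENNReal.rpow_le_rpow_iff (z := 3) (by norm_num), eLpNorm_three_rpow]
    simp only [conv_dyadicKernel (hΨ i) (hBl l) hε0 n]
    refine (lintegral_sum_scaledAverage_rpow_le (hΨ i).continuous (hΨ i).2 (hBl l) hW0 (hW i) hs0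
      (fun t ht z => hcon i l t z ht) hε0 n).trans (le_trans ?_ hs)
    gcongr
    exact lintegral_component_rpow_le hC l
  have hfirst : ∀ j, eLpNorm ((fun x => A x j) - realConv (fun x => ∑ i, partialDeriv i
      (dyadicKernel (Ψ i) ε n) x) fun x => A x j) 3 volume ≤ δ + δ := by
    intro j
    rw [conv_sum_partialDeriv_dyadicKernel hρ hρs hΨ hdiv (hAl j) hε0 n, ← sub_add]
    have hm1 := (continuous_scaledAverage hρ hρs (hAl j) hε0).aestronglyMeasurable (μ := volume)
    have hm2 := (continuous_scaledAverage hρ hρs (hAl j)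
      (by positivity : 0 < ε * 2 ^ n)).aestronglyMeasurable (μ := volume)
    refine (eLpNorm_add_le ((hA.component j).1.sub hm1) hm2 (by norm_num)).trans ?_
    exact add_le_add (hε1 j) (hn j)
  have hle : (1 : ℝ≥0∞) ≤ ∑ _j : Fin 3, ((δ + δ) + (δ + δ)) := by
    rw [← hnorm]
    exact hmain.trans (Finset.sum_le_sum fun j _ =>
      add_le_add (hfirst j) (add_le_add (hpot _ _) (hpot _ _)))
  have hδr : δ = ENNReal.ofReal (1 / 20) := by
    rw [hδ, one_div, ENNReal.ofReal_inv_of_pos (by norm_num)]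
    norm_num
  rw [Finset.sum_const, Finset.card_univ, Fintype.card_fin, hδr,
    ← ENNReal.ofReal_add (by norm_num) (by norm_num),
    ← ENNReal.ofReal_add (by norm_num) (by norm_num), ← ENNReal.ofReal_nsmul,
    ENNReal.one_le_ofReal] at hle
  norm_num at hle

end Concentration

/-! ### Rescaled fields -/

section Rescaling

theorem aestronglyMeasurable_rescale_and_eLpNorm_eq {B : E3 → E3} (hB : AEStronglyMeasurable B volume) {t : ℝ}
    (ht : 0 < t) (a : E3) :
    AEStronglyMeasurable (fun x => t ^ 2 • B (t • (x - a))) volume ∧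
    eLpNorm (fun x => t ^ 2 • B (t • (x - a))) (3 / 2) volume = eLpNorm B (3 / 2) volume := by
  have hmap : Measure.map (fun x : E3 => t • (x - a)) volume =
      ENNReal.ofReal ((t ^ 3)⁻¹) • (volume : Measure E3) := by
    have h1 := Measure.map_addHaar_smul (volume : Measure E3) ht.ne'
    rw [← map_sub_right_eq_self (volume : Measure E3) a,
      Measure.map_map (measurable_const_smul t) (measurable_sub_const a),
      map_sub_right_eq_self (volume : Measure E3) a] at h1
    have h2 : |(t ^ Module.finrank ℝ E3)⁻¹| = (t ^ 3)⁻¹ := by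
      rw [abs_of_nonneg (by positivity)]
      simp
    rw [h2] at h1
    exact h1
  have hg : Measurable fun x : E3 => t • (x - a) := by fun_prop
  have hB' : AEStronglyMeasurable B (Measure.map (fun x : E3 => t • (x - a)) volume) := by
    rw [hmap]
    exact hB.smul_measure _
  refine ⟨(hB'.comp_measurable hg).const_smul (t ^ 2), ?_⟩
  have h3 : eLpNorm (fun x => B (t • (x - a))) (3 / 2) volume =
      ENNReal.ofReal ((t ^ 2)⁻¹) * eLpNorm B (3 / 2) volume := by
    have h4 := eLpNorm_map_measure (p := 3 / 2) hB' hg.aemeasurable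
    rw [hmap, eLpNorm_smul_measure_of_ne_top (ENNReal.div_ne_top (by simp) (by simp))] at h4
    rw [show (fun x => B (t • (x - a))) = B ∘ fun x => t • (x - a) from rfl, ← h4, smul_eq_mul]
    congr 1
    rw [ENNReal.ofReal_rpow_of_nonneg (by positivity) (by positivity)]
    congr 1
    have h5 : (t ^ 3)⁻¹ = ((t⁻¹) ^ (3 : ℝ)) := by
      rw [← inv_pow]
      exact (Real.rpow_natCast _ 3).symm
    rw [h5, ← Real.rpow_mul (by positivity)]
    rw [show (3 : ℝ) * (1 / (3 / 2 : ℝ≥0∞)).toReal = (2 : ℕ) by simp; norm_num, Real.rpow_natCast,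
      inv_pow]
  have h6 : eLpNorm (fun x => t ^ 2 • B (t • (x - a))) (3 / 2) volume =
      ‖t ^ 2‖ₑ * eLpNorm (fun x => B (t • (x - a))) (3 / 2) volume :=
    eLpNorm_const_smul (t ^ 2) _ _ _
  rw [h6, h3, Real.enorm_eq_ofReal (by positivity), ← mul_assoc,
    ← ENNReal.ofReal_mul (by positivity), mul_inv_cancel₀ (by positivity), ENNReal.ofReal_one,
    one_mul]

theorem integral_comp_neg_mul_rescale (w b : E3 → ℝ) {t : ℝ} (ht : 0 < t) (z : E3) :
    ∫ x, w (-x) * (t ^ 2 * b (t • (x - -(t⁻¹ • z)))) = t ^ 2 * scaledAverage w b t z := by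
  rw [scaledAverage, ← integral_const_mul, ← integral_neg_eq_self]
  refine integral_congr_ae (ae_of_all _ fun x => ?_)
  simp only [neg_neg, sub_neg_eq_add, smul_add, smul_smul, mul_inv_cancel₀ ht.ne', one_smul,
    smul_neg]
  rw [neg_add_eq_sub]
  ring

end Rescaling

instance holderConjugate_three_halves_three : ENNReal.HolderConjugate (3 / 2) 3 := by
  refine ENNReal.HolderConjugate.of_toReal ?_
  rw [Real.holderConjugate_iff]
  norm_num

theorem exists_dual_eq_integral_component {w : E3 → ℝ} (hw : MemLp w 3 volume) (l : Fin 3) :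
    ∃ ℓ : StrongDual ℝ (Lp E3 (3 / 2) (volume : Measure E3)), ∀ (f : E3 → E3)
      (hf : MemLp f (3 / 2) volume), ℓ (hf.toLp f) = ∫ x, w x * f x l := by
  have : Fact ((1 : ℝ≥0∞) ≤ 3) := ⟨by norm_num⟩
  refine ⟨(ContinuousLinearMap.lpPairing volume 3 (3 / 2) (ContinuousLinearMap.mul ℝ ℝ)
    (hw.toLp w)).comp ((EuclideanSpace.proj (𝕜 := ℝ) l : E3 →L[ℝ] ℝ).compLpL (3 / 2) volume),
    fun f hf => ?_⟩
  rw [ContinuousLinearMap.comp_apply, ContinuousLinearMap.lpPairing_eq_integral]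
  refine integral_congr_ae ?_
  filter_upwards [hw.coeFn_toLp, ContinuousLinearMap.coeFn_compLpL
    (EuclideanSpace.proj (𝕜 := ℝ) l : E3 →L[ℝ] ℝ) (hf.toLp f), hf.coeFn_toLp] with x h1 h2 h3
  rw [h1, h2, h3]
  rfl

theorem proposition7 (A B : ℕ → E3 → E3)
    (hA : ∀ n, A n ∈ SpaceY)
    (hB : ∀ n, HasWeakCurl (A n) (B n))
    (hnorm : ∀ n, modGradNorm (A n) = 1)
    (hbdd : ∃ C : ℝ≥0, ∀ n, eLpNorm (B n) (3 / 2) volume ≤ C) :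
    ∃ (lam : ℕ → ℝ) (a : ℕ → E3), (∀ n, 0 < lam n) ∧
      ∃ ns : ℕ → ℕ, StrictMono ns ∧
        ∃ Btilde : E3 → E3, ¬ (Btilde =ᵐ[volume] 0) ∧
          TendstoWeaklyLp (3 / 2)
            (fun k x => (lam (ns k)) ^ 2 • B (ns k) (lam (ns k) • (x - a (ns k)))) Btilde := by
  obtain ⟨C, hC⟩ := hbdd
  obtain ⟨ρ, Ψ, hρ, hρs, hρ1, hΨ, hdiv⟩ := exists_telescoping_kernel
  obtain ⟨s, hs, hscale⟩ := exists_scale_lt_scaledAverage hρ hρs hρ1 hΨ hdiv C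
  choose i l t z ht hlt using fun n => hscale (A n) (B n) (hA n).1 (hB n) (hnorm n) (hC n)
  set a : ℕ → E3 := fun n => -((t n)⁻¹ • z n) with ha
  set u : ℕ → E3 → E3 := fun n x => t n ^ 2 • B n (t n • (x - a n)) with hu
  have hum : ∀ n, MemLp (u n) (3 / 2) volume := fun n => by
    obtain ⟨h1, h2⟩ := aestronglyMeasurable_rescale_and_eLpNorm_eq (hB n).2.1.aestronglyMeasurable (ht n) (a n)
    exact ⟨h1, by rw [h2]; exact (hC n).trans_lt ENNReal.coe_lt_top⟩
  have hun : ∀ n, ‖(hum n).toLp (u n)‖ ≤ C := fun n => by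
    obtain ⟨h1, h2⟩ := aestronglyMeasurable_rescale_and_eLpNorm_eq (hB n).2.1.aestronglyMeasurable (ht n) (a n)
    rw [Lp.norm_toLp]
    refine ENNReal.toReal_le_coe_of_le_coe ?_
    rw [h2]
    exact hC n
  have : Fact ((1 : ℝ≥0∞) ≤ 3) := ⟨by norm_num⟩
  obtain ⟨v, ns, hns, hlim⟩ := exists_subseq_tendsto_dual (p := 3 / 2) (q := 3)
    (ENNReal.div_ne_top (by simp) (by simp)) (by simp) hun
  refine ⟨t, a, ht, ns, hns, v, fun hv0 => ?_, fun k => hum (ns k), Lp.memLp v, fun ℓ => ?_⟩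
  · have hv : v = 0 := Lp.eq_zero_iff_ae_eq_zero.2 hv0
    have hw : ∀ i, MemLp (fun x => Ψ i (-x)) 3 volume := fun i =>
      ((hΨ i).continuous.comp continuous_neg).memLp_of_hasCompactSupport
        ((hΨ i).2.comp_homeomorph (Homeomorph.neg E3))
    choose ℓ hℓ using fun i l => exists_dual_eq_integral_component (hw i) l
    have h1 : ∀ i l, Tendsto (fun k => |ℓ i l ((hum (ns k)).toLp (u (ns k)))|) atTop (𝓝 0) := by
      intro i l
      have := (hlim (ℓ i l)).abs
      rwa [hv, map_zero, abs_zero] at this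
    have h2 : ∀ᶠ k in atTop, ∀ i l, |ℓ i l ((hum (ns k)).toLp (u (ns k)))| < s :=
      eventually_all.2 fun i => eventually_all.2 fun l => (h1 i l).eventually (gt_mem_nhds hs)
    obtain ⟨k, hk⟩ := h2.exists
    have h3 := hk (i (ns k)) (l (ns k))
    have h4 := integral_comp_neg_mul_rescale (Ψ (i (ns k))) (fun x => B (ns k) x (l (ns k)))
      (ht (ns k)) (z (ns k))
    rw [hℓ] at h3
    simp only [hu, ha, PiLp.smul_apply, smul_eq_mul] at h3
    rw [h4, abs_mul, abs_of_nonneg (by positivity)] at h3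
    exact lt_asymm h3 (hlt (ns k))
  · rw [Lp.toLp_coeFn]
    exact hlim ℓ
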